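/- **Theorem (Asymptotically exact reduction).** Let $\mathcal H=\mathbb C^n$, let $\mathfrak B(\mathcal H)$ be the space of linear operators on $\mathcal H$ and $\mathfrak D(\mathcal H)$ the set of density operators (positive semidefinite, trace one). Let $\mathcal L$ be a Lindblad generator, $$\mathcal L(\rho)=-i[H,\rho]+\sum_{j=1}^{m}\Big(V_j\rho V_j^\dagger-\tfrac12\{V_j^\dagger V_j,\rho\}\Big),\qquad H=H^\dagger,\ V_j\in\mathfrak B(\mathcal H),$$ and let $\mathscr C=\operatorname{span}\{X\in\mathfrak B(\mathcal H):\ \mathcal L(X)=i\omega X\text{ for some }\omega\in\mathbb R\}$ be its center manifold. Let $\Delta_{\mathcal L}=\min\{|\operatorname{Re}\lambda|:\lambda\in\operatorname{sp}(\mathcal L),\ \operatorname{Re}\lambda\ne0\}$ be its spectral gap (with the convention $\Delta_{\mathcal L}=0$ if there is no such $\lambda$; see item 3). There is a unique completely positive trace-preserving (CPTP) linear map $\mathcal P:\mathfrak B(\mathcal H)\to\mathfrak B(\mathcal H)$ with $\mathcal P^2=\mathcal P$, $\operatorname{Im}\mathcal P=\mathscr C$ and $\mathcal P\mathcal L=\mathcal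 L\mathcal P$. Moreover $\mathscr C$ has a Wedderburn decomposition: there are an orthogonal decomposition $\mathcal H\cong\bigoplus_k(\mathcal H_{F,k}\otimes\mathcal H_{G,k})\oplus\mathcal H_R$ with finitely many blocks and $\mathcal H_{F,k}\neq0$, implemented by a unitary $U$ from the direct sum onto $\mathcal H$, and positive definite density operators $\tau_k$ on $\mathcal H_{G,k}$ such that $$\mathscr C=U\Big[\bigoplus_k\big(\mathfrak B(\mathcal H_{F,k})\otimes\tau_k\big)\oplus 0_R\Big]U^\dagger .$$ Fix any such decomposition. Let $W_k:\mathcal H\to\mathcal H_{F,k}\otimes\mathcal H_{G,k}$ be the $k$-th block row of $U^\dagger$, let $\check{\mathscr A}=\bigoplus_k\mathfrak B(\mathcal H_{F,k})$, and define $$\mathcal R(X)=\bigoplus_k\operatorname{tr}_{\mathcal H_{G,k}}\big(W_k\,\mathcal P(X)\,W_k^\dagger\big)\quad(X\in\mathfrak B(\mathcal H)),\qquad \mathcal J\Big(\bigoplus_kX_k\Big)=U\Big[\bigoplus_k(X_k\otimes\tau_k)\oplus0_R\Big]U^\dagger .$$ Then $\mathcal R:\mathfrak B(\mathcal H)\to\check{\mathscr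 A}$ and $\mathcal J:\check{\mathscr A}\to\mathfrak B(\mathcal H)$ are CPTP, $\mathcal J\mathcal R=\mathcal P$, $\mathcal R\mathcal J=\mathrm{id}_{\check{\mathscr A}}$, and $\mathcal R(X)=\bigoplus_k\operatorname{tr}_{\mathcal H_{G,k}}(W_kXW_k^\dagger)$ whenever $X=\Pi X\Pi$, where $\Pi=\sum_kW_k^\dagger W_k$ is the orthogonal projection onto the orthogonal complement of $U\mathcal H_R$. Put $\check{\mathcal L}=\mathcal R\mathcal L\mathcal J:\check{\mathscr A}\to\check{\mathscr A}$. Then: 1. For all $\rho\in\mathscr C$ and all $t\ge0$, $e^{\mathcal Lt}(\rho)=\mathcal J e^{\check{\mathcal L}t}\mathcal R(\rho)$. 2. For all $\rho\in\mathfrak D(\mathcal H)$, $\lim_{t\to+\infty}\big[e^{\mathcal Lt}(\rho)-\mathcal J e^{\check{\mathcal L}t}\mathcal R(\rho)\big]=0$. 3. For every norm (indeed every seminorm) $\|\cdot\|$ on $\mathfrak B(\mathcal H)$, every $\rho\in\mathfrak D(\mathcal H)$ and every $\delta>0$ there is a constant $\Gamma>0$ such that $$\big\|e^{\mathcal Lt}(\rho)-\mathcal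 J e^{\check{\mathcal L}t}\mathcal R(\rho)\big\|\le\Gamma e^{-(\Delta_{\mathcal L}-\delta)t}\qquad\text{for all }t\ge0 .$$ If every eigenvalue of $\mathcal L$ is purely imaginary, then $e^{\mathcal Lt}=\mathcal J e^{\check{\mathcal L}t}\mathcal R$ on all of $\mathfrak B(\mathcal H)$ for all $t\ge0$. 4. There are Hermitian operators $H_{F,k}\in\mathfrak B(\mathcal H_{F,k})$ such that, with $\check H=\bigoplus_kH_{F,k}$, $\check{\mathcal L}(\check X)=-i[\check H,\check X]$ for all $\check X\in\check{\mathscr A}$. -/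

import Mathlib

open scoped Kronecker ComplexOrder

noncomputable section

/-- Operators on the Hilbert space `ℂⁿ`. -/
abbrev Op (n : ℕ) : Type := Matrix (Fin n) (Fin n) ℂ

/-- Super-operators: linear maps on the space of operators. -/
abbrev SuperOp (n : ℕ) : Type := Module.End ℂ (Op n)

/-- Density operators: positive semidefinite with unit trace. -/
def IsDensity {n : ℕ} (ρ : Op n) : Prop := ρ.PosSemidef ∧ ρ.trace = 1

/-- `L` is a Lindblad generator: `L ρ = -i[H, ρ] + ∑ₖ (Vₖ ρ Vₖ† - ½ {Vₖ† Vₖ, ρ})`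
with `H` Hermitian and finitely many noise operators `Vₖ`. -/
def IsLindbladGenerator {n : ℕ} (L : SuperOp n) : Prop :=
  ∃ (H : Op n) (m : ℕ) (V : Fin m → Op n), H.IsHermitian ∧
    ∀ ρ : Op n, L ρ = -(Complex.I • (H * ρ - ρ * H)) +
      ∑ k, (V k * ρ * (V k).conjTranspose -
        (1 / 2 : ℂ) • ((V k).conjTranspose * V k * ρ + ρ * ((V k).conjTranspose * V k)))

/-- Complete positivity of a linear map between *-algebras, where an element is positive when it
is of the form `y* y`: every entrywise amplification `Mₘ(A) → Mₘ(B)` preserves positivity.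
It is used only for finite direct sums of full matrix algebras, where for every `m` the elements
`y* y` of `Mₘ(A)` are exactly the positive semidefinite ones. -/
def IsCompletelyPositive {A B : Type} [Ring A] [StarRing A] [Algebra ℂ A]
    [Ring B] [StarRing B] [Algebra ℂ B] (Φ : A →ₗ[ℂ] B) : Prop :=
  ∀ (m : ℕ) (X : Matrix (Fin m) (Fin m) A), ∃ Y : Matrix (Fin m) (Fin m) B,
    (star X * X).map Φ = star Y * Y

/-- The exponential `e^{tL} x = ∑ₖ (tᵏ / k!) Lᵏ x` of a linear map `L`, applied to a vector `x`.
It is used only on finite-dimensional spaces with their canonical topology, where the series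
converges for all `L`, `t` and `x`. -/
def expMap {V : Type} [AddCommGroup V] [Module ℂ V] [TopologicalSpace V]
    (L : V →ₗ[ℂ] V) (t : ℝ) (x : V) : V :=
  ∑' k : ℕ, ((t : ℂ) ^ k / (k.factorial : ℂ)) • (L ^ k) x

/-- The center manifold: the span of the eigenoperators with purely imaginary eigenvalue. -/
def centerManifold {n : ℕ} (L : SuperOp n) : Submodule ℂ (Op n) :=
  Submodule.span ℂ {X | ∃ ω : ℝ, L X = (Complex.I * (ω : ℂ)) • X}

/-- The decay rates `|Re λ|` of the eigenvalues `λ` of `L` that are not purely imaginary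
(zero counts as purely imaginary). -/
def decayRates {n : ℕ} (L : SuperOp n) : Set ℝ :=
  {r | ∃ z : ℂ, Module.End.HasEigenvalue L z ∧ z.re ≠ 0 ∧ r = |z.re|}

/-- The spectral gap, the least decay rate. The set is finite, so the infimum is a minimum
unless the set is empty. -/
def spectralGap {n : ℕ} (L : SuperOp n) : ℝ := sInf (decayRates L)

/-- `P` is a completely positive, trace-preserving `L`-spectral projector onto the
center manifold of `L`. -/
structure IsCenterProjection {n : ℕ} (L P : SuperOp n) : Prop where
  completelyPositive : IsCompletelyPositive P
  trace_preserving : ∀ X, (P X).trace = X.trace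
  idempotent : P * P = P
  range_eq : LinearMap.range P = centerManifold L
  commute : P * L = L * P

/-- The partial trace over the second tensor factor. -/
def partialTrace (f g : ℕ) :
    Matrix (Fin f × Fin g) (Fin f × Fin g) ℂ →ₗ[ℂ] Matrix (Fin f) (Fin f) ℂ where
  toFun Y := Matrix.of fun i j => ∑ s, Y (i, s) (j, s)
  map_add' Y Z := by
    ext i j
    simp [Finset.sum_add_distrib]
  map_smul' c Y := by
    ext i j
    simp [Finset.mul_sum]

/-- An orthogonal decomposition `ℂⁿ = ⨁ₖ (F k ⊗ G k) ⊕ R` with `F k = ℂ^(f k)`, `F k ≠ 0`,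
`G k = ℂ^(g k)`, together with a full-rank state `τ k` on each `G k`.
The decomposition is given by the block maps `W k : ℂⁿ → F k ⊗ G k`, which are co-isometries
with mutually orthogonal initial spaces; that is, `W k` is the `k`-th block row of `U†`, with `U`
the unitary from the direct sum onto `ℂⁿ`, and `R` is the orthogonal complement of all the
initial spaces. -/
structure BlockData (n : ℕ) where
  /-- the number of blocks -/
  K : ℕ
  /-- the dimensions of the spaces `F k` -/
  f : Fin K → ℕ
  /-- the dimensions of the spaces `G k` -/
  g : Fin K → ℕ
  f_pos : ∀ k, 0 < f k
  /-- the block maps -/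
  W : ∀ k, Matrix (Fin (f k) × Fin (g k)) (Fin n) ℂ
  W_self : ∀ k, W k * (W k).conjTranspose = 1
  W_orth : ∀ k l, k ≠ l → W k * (W l).conjTranspose = 0
  /-- the states on the spaces `G k` -/
  τ : ∀ k, Matrix (Fin (g k)) (Fin (g k)) ℂ
  τ_posDef : ∀ k, (τ k).PosDef
  τ_trace : ∀ k, (τ k).trace = 1

namespace BlockData

variable {n : ℕ} (D : BlockData n)

/-- The reduced algebra `⨁ₖ B(F k)`. -/
abbrev Reduced : Type := ∀ k, Matrix (Fin (D.f k)) (Fin (D.f k)) ℂ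

/-- The injection `⨁ₖ Xₖ ↦ ∑ₖ Wₖ† (Xₖ ⊗ τₖ) Wₖ = U [⨁ₖ (Xₖ ⊗ τₖ) ⊕ 0] U†`. -/
def injection : D.Reduced →ₗ[ℂ] Op n where
  toFun X := ∑ k, (D.W k).conjTranspose * (X k ⊗ₖ D.τ k) * D.W k
  map_add' X Y := by
    simp [Matrix.add_kronecker, Matrix.mul_add, Matrix.add_mul, Finset.sum_add_distrib]
  map_smul' c X := by
    simp [Matrix.smul_kronecker, Finset.smul_sum]

/-- The block compression `X ↦ ⨁ₖ tr_{G k} (Wₖ X Wₖ†)`. -/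
def compression : Op n →ₗ[ℂ] D.Reduced where
  toFun X := fun k => partialTrace (D.f k) (D.g k) (D.W k * X * (D.W k).conjTranspose)
  map_add' X Y := by
    funext k
    simp [Matrix.mul_add, Matrix.add_mul]
  map_smul' c X := by
    funext k
    simp

/-- The reduction `R` attached to a projector `P`: first project, then compress the blocks. -/
def reduction (P : SuperOp n) : Op n →ₗ[ℂ] D.Reduced := D.compression ∘ₗ P

/-- The orthogonal projection of `ℂⁿ` onto `⨁ₖ (F k ⊗ G k)`. -/
def supportProj : Op n := ∑ k, (D.W k).conjTranspose * D.W k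

/-- The trace on the reduced algebra. -/
def reducedTrace (X : D.Reduced) : ℂ := ∑ k, (X k).trace

/-- `𝒜 = U [⨁ₖ (B(F k) ⊗ τ k) ⊕ 0] U†`: the data form a Wedderburn decomposition of `𝒜`. -/
def IsWedderburn (𝒜 : Submodule ℂ (Op n)) : Prop := 𝒜 = LinearMap.range D.injection

/-- The reduced generator `R L J`, a linear map on the reduced algebra. -/
def reducedGenerator (L P : SuperOp n) : D.Reduced →ₗ[ℂ] D.Reduced :=
  D.reduction P ∘ₗ L ∘ₗ D.injection

end BlockData

end

/-! Three facts carry the theorem.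

Spectral splitting. Write `L X = G X + X G† + ∑ V X V†`. Then `1 + ε L + ε² G · G†` is exactly a
Kraus map for `ε ≥ 0`, and its `N`-th power at `ε = t / N` tends to `e^{tL}`. Positivity of the Choi
matrix survives limits, so the flow is Kraus and trace preserving, hence bounded. Boundedness puts
the spectrum in the closed left half plane and makes the imaginary eigenvalues semisimple, so the
space is spanned by the center manifold and the decaying generalized eigenspaces. A projection onto
the former commuting with `L` must kill the latter, which gives uniqueness; existence and positivity
come from a limit of `e^{m L}` along suitable integers (`BoundedFlow.exists_projection`). The
reduction error is the flow of `ρ - P ρ`, which lies in the decaying part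
(`IsCenterProjection.error_eq`).

Shape of the range. For a trace-preserving Kraus map with a positive fixed point `σ`, a trace
identity forces certain operators to commute with all Kraus operators on the support of `σ`
(`kraus_mul_fixed_eq`). These operators form a `*`-algebra over which the range of `P` is a bimodule
and whose trace pairings separate the range. Decomposing the algebra into blocks `B(F) ⊗ 1` turns
the range into the sum of the `B(F) ⊗ τ`.

Absence of dissipation. The reduced generator has imaginary spectrum, so its trace has real part
zero. Up to a factor `-2`, this trace is a weighted sum of nonnegative dissipation terms over matrix
units. Hence all of them vanish, the jump operators commute with the reduced algebra on the support,
and what remains is a Hermitian commutator. -/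

noncomputable section

/-! ### The exponential as a limit of powers. -/

section ExponentialLimit

open Filter Topology Asymptotics

/-- Telescoping. The unit is only required to have norm at most one, so that the endomorphisms of
the zero space are covered. -/
theorem norm_pow_sub_pow_le_mul {A : Type*} [NormedRing A] (h1 : ‖(1 : A)‖ ≤ 1) {a b : A} {M : ℝ} (hM : 1 ≤ M)
    (ha : ‖a‖ ≤ M) (hb : ‖b‖ ≤ M) (k : ℕ) : ‖a ^ k - b ^ k‖ ≤ k * M ^ k * ‖a - b‖ := by
  have hbk : ∀ k : ℕ, ‖b ^ k‖ ≤ M ^ k := by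
    intro k
    induction k with
    | zero => simpa using h1
    | succ k ih =>
      rw [pow_succ, pow_succ]
      exact (norm_mul_le _ _).trans (mul_le_mul ih hb (norm_nonneg _) (by positivity))
  induction k with
  | zero => simp
  | succ k ih =>
    have e : a ^ (k + 1) - b ^ (k + 1) = a * (a ^ k - b ^ k) + (a - b) * b ^ k := by
      rw [pow_succ', pow_succ']; noncomm_ring
    have h2 : ‖a * (a ^ k - b ^ k)‖ ≤ M * (k * M ^ k * ‖a - b‖) :=
      (norm_mul_le _ _).trans (mul_le_mul ha ih (norm_nonneg _) (by positivity))
    have h3 : ‖(a - b) * b ^ k‖ ≤ ‖a - b‖ * M ^ k :=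
      (norm_mul_le _ _).trans (mul_le_mul_of_nonneg_left (hbk k) (norm_nonneg _))
    have h4 : ‖a - b‖ * M ^ k ≤ ‖a - b‖ * M ^ (k + 1) :=
      mul_le_mul_of_nonneg_left (pow_le_pow_right₀ hM (Nat.le_succ k)) (norm_nonneg _)
    rw [e]
    refine (norm_add_le _ _).trans ?_
    push_cast
    calc _ ≤ M * (k * M ^ k * ‖a - b‖) + ‖a - b‖ * M ^ (k + 1) := by linarith
      _ = _ := by ring

/-- The base differs from `e^{x/N}` by `o(1/N)` and both have norm at most `1 + c/N`, so the `N`-th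
powers differ by at most `N e^c · o(1/N)`. The free second-order term `y` is what later completes an
Euler step to a Kraus map. -/
theorem tendsto_pow_exp_of_second_order {A : Type*} [NormedRing A] [NormedAlgebra ℂ A]
    [CompleteSpace A] (h1 : ‖(1 : A)‖ ≤ 1) (x y : A) :
    Tendsto (fun N : ℕ => (1 + ((N : ℂ)⁻¹) • x + ((N : ℂ)⁻¹) ^ 2 • y) ^ N) atTop
      (𝓝 (NormedSpace.exp x)) := by
  let +nondep : NormedAlgebra ℚ A := .restrictScalars ℚ ℂ A
  have hs : Tendsto (fun N : ℕ => ((N : ℂ)⁻¹)) atTop (𝓝 0) := by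
    have := tendsto_inv_atTop_nhds_zero_nat (𝕜 := ℂ)
    exact this
  have hd : (fun s : ℂ => NormedSpace.exp (s • x) - 1 - s • x) =o[𝓝 0] fun s : ℂ => s := by
    have := (hasDerivAt_exp_smul_const x (0 : ℂ)).isLittleO
    simpa using this
  have hsq : (fun s : ℂ => s ^ 2 • y) =o[𝓝 0] fun s : ℂ => s := by
    have h : (fun s : ℂ => s ^ 2) =o[𝓝 0] fun s : ℂ => s := by
      simpa using isLittleO_pow_id (𝕜 := ℂ) (n := 2) (by norm_num)
    have h' := h.smul_isBigO (isBigO_refl (fun _ : ℂ => y) (𝓝 0))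
    have h'' : (fun s : ℂ => s • y) =O[𝓝 0] fun s : ℂ => s := by
      refine IsBigO.of_bound ‖y‖ (Eventually.of_forall fun s => ?_)
      rw [norm_smul, mul_comm]
    exact h'.trans_isBigO h''
  have hdiff : (fun s : ℂ => (1 + s • x + s ^ 2 • y) - NormedSpace.exp (s • x)) =o[𝓝 0]
      fun s : ℂ => s := by
    refine (hsq.sub hd).congr_left fun s => ?_
    abel
  have hdiffN := hdiff.comp_tendsto hs
  have hdN := (hd.comp_tendsto hs)
  rw [isLittleO_iff] at hdiffN hdN
  have hexp : ∀ N : ℕ, N ≠ 0 → NormedSpace.exp (((N : ℂ)⁻¹) • x) ^ N = NormedSpace.exp x := by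
    intro N hN
    rw [← NormedSpace.exp_nsmul, ← Nat.cast_smul_eq_nsmul ℂ, smul_smul,
      mul_inv_cancel₀ (Nat.cast_ne_zero.2 hN), one_smul]
  set c : ℝ := ‖x‖ + 2 with hc
  have hc0 : 0 ≤ c := by positivity
  rw [tendsto_iff_norm_sub_tendsto_zero]
  rw [Metric.tendsto_atTop]
  intro ε hε
  -- The bound `1` serves the norm estimate for `a`, which is why `c` exceeds `‖x‖ + 1` by one; the
  -- other bound gives the final `ε / 2`.
  have hη : 0 < min 1 (ε / (2 * Real.exp c)) := by positivity
  have e1 := hdiffN hη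
  have e2 := hdN (zero_lt_one)
  obtain ⟨N0, hN0⟩ := eventually_atTop.1 (e1.and (e2.and (eventually_ge_atTop 1)))
  refine ⟨N0, fun N hN => ?_⟩
  obtain ⟨g1, g2, g3⟩ := hN0 N hN
  have hNpos : (0 : ℝ) < N := by exact_mod_cast g3
  have hsN : ‖((N : ℂ)⁻¹)‖ = (N : ℝ)⁻¹ := by simp
  simp only [Function.comp_apply] at g1 g2
  rw [hsN] at g1 g2
  set a := 1 + ((N : ℂ)⁻¹) • x + ((N : ℂ)⁻¹) ^ 2 • y
  set b := NormedSpace.exp (((N : ℂ)⁻¹) • x)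
  have hb' : ‖b‖ ≤ 1 + (‖x‖ + 1) * (N : ℝ)⁻¹ := by
    have : b = (b - 1 - ((N : ℂ)⁻¹) • x) + 1 + ((N : ℂ)⁻¹) • x := by abel
    rw [this]
    refine (norm_add₃_le).trans ?_
    rw [norm_smul, hsN]
    linarith
  have hN1 : 0 ≤ (N : ℝ)⁻¹ := by positivity
  have hb : ‖b‖ ≤ 1 + c * (N : ℝ)⁻¹ := by
    refine hb'.trans ?_
    rw [hc]; nlinarith
  have ha : ‖a‖ ≤ 1 + c * (N : ℝ)⁻¹ := by
    have : a = (a - b) + b := by abel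
    rw [this]
    refine (norm_add_le _ _).trans ?_
    have : ‖a - b‖ ≤ 1 * (N : ℝ)⁻¹ :=
      g1.trans (mul_le_mul_of_nonneg_right (min_le_left _ _) hN1)
    rw [hc]; nlinarith
  have key := norm_pow_sub_pow_le_mul h1 (M := 1 + c * (N : ℝ)⁻¹) (by nlinarith) ha hb N
  have hMN : (1 + c * (N : ℝ)⁻¹) ^ N ≤ Real.exp c := by
    have h5 : 1 + c * (N : ℝ)⁻¹ ≤ Real.exp (c * (N : ℝ)⁻¹) := by
      have := Real.add_one_le_exp (c * (N : ℝ)⁻¹); linarith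
    calc _ ≤ (Real.exp (c * (N : ℝ)⁻¹)) ^ N := pow_le_pow_left₀ (by positivity) h5 N
      _ = Real.exp c := by
        rw [← Real.exp_nat_mul]; congr 1; field_simp
  rw [hexp N (by omega)] at key
  rw [Real.dist_eq, sub_zero, abs_of_nonneg (norm_nonneg _)]
  calc _ ≤ N * (1 + c * (N : ℝ)⁻¹) ^ N * ‖a - b‖ := key
    _ ≤ N * Real.exp c * (ε / (2 * Real.exp c) * (N : ℝ)⁻¹) := by
        have : ‖a - b‖ ≤ ε / (2 * Real.exp c) * (N : ℝ)⁻¹ :=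
          g1.trans (mul_le_mul_of_nonneg_right (min_le_right _ _) hN1)
        gcongr
    _ = ε / 2 := by field_simp
    _ < ε := by linarith

end ExponentialLimit

/-! ### The exponential series on a finite-dimensional space. -/

section ExpMap

open Filter Topology

variable {V : Type} [NormedAddCommGroup V] [NormedSpace ℂ V] [FiniteDimensional ℂ V]

/-- An endomorphism of a finite-dimensional space as a continuous one. -/
abbrev Module.End.clm (L : Module.End ℂ V) : V →L[ℂ] V :=
  Module.End.toContinuousLinearMap V L

theorem hasSum_expMap_exp (L : Module.End ℂ V) (t : ℝ) (x : V) :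
    HasSum (fun k : ℕ => ((t : ℂ) ^ k / (k.factorial : ℂ)) • (L ^ k) x)
      (NormedSpace.exp ((t : ℂ) • L.clm) x) := by
  have : CompleteSpace (V →L[ℂ] V) := FiniteDimensional.complete ℂ _
  have h := NormedSpace.exp_series_hasSum_exp' (𝕂 := ℂ) ((t : ℂ) • L.clm)
  have h2 := h.mapL (ContinuousLinearMap.apply ℂ V x)
  refine h2.congr_fun fun k => ?_
  rw [ContinuousLinearMap.apply_apply, smul_pow, smul_smul, smul_apply, Module.End.clm, ← map_pow,
    div_eq_inv_mul]
  rfl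

theorem expMap_eq_exp (L : Module.End ℂ V) (t : ℝ) (x : V) :
    expMap L t x = NormedSpace.exp ((t : ℂ) • L.clm) x :=
  (hasSum_expMap_exp L t x).tsum_eq

theorem exists_end_eq_expMap (L : Module.End ℂ V) (t : ℝ) :
    ∃ E : Module.End ℂ V, ∀ x, E x = expMap L t x :=
  ⟨(NormedSpace.exp ((t : ℂ) • L.clm) : V →L[ℂ] V), fun x => (expMap_eq_exp L t x).symm⟩

theorem hasSum_expMap (L : Module.End ℂ V) (t : ℝ) (x : V) :
    HasSum (fun k : ℕ => ((t : ℂ) ^ k / (k.factorial : ℂ)) • (L ^ k) x) (expMap L t x) := by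
  rw [expMap_eq_exp]; exact hasSum_expMap_exp L t x

theorem expMap_add (L : Module.End ℂ V) (t : ℝ) (x y : V) :
    expMap L t (x + y) = expMap L t x + expMap L t y := by
  simp only [expMap_eq_exp, map_add]

theorem expMap_sub (L : Module.End ℂ V) (t : ℝ) (x y : V) :
    expMap L t (x - y) = expMap L t x - expMap L t y := by
  simp only [expMap_eq_exp, map_sub]

theorem expMap_intertwine {V' : Type} [NormedAddCommGroup V'] [NormedSpace ℂ V']
    [FiniteDimensional ℂ V'] (L : Module.End ℂ V) (L' : Module.End ℂ V') (J : V' →ₗ[ℂ] V)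
    (h : ∀ y, L (J y) = J (L' y)) (t : ℝ) (y : V') : expMap L t (J y) = J (expMap L' t y) := by
  have hk : ∀ k : ℕ, (L ^ k) (J y) = J ((L' ^ k) y) := by
    intro k
    induction k with
    | zero => simp
    | succ k ih => rw [pow_succ', pow_succ', Module.End.mul_apply, Module.End.mul_apply, ih, h]
  have h1 := (hasSum_expMap L' t y).mapL (LinearMap.toContinuousLinearMap J)
  refine (hasSum_expMap L t (J y)).unique (h1.congr_fun ?_)
  intro k
  simp [hk]

theorem tendsto_pow_expMap (L B : Module.End ℂ V) (t : ℝ) (x : V) :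
    Tendsto (fun N : ℕ => ((1 + ((t / N : ℝ) : ℂ) • L + ((t / N : ℝ) : ℂ) ^ 2 • B) ^ N) x) atTop
      (𝓝 (expMap L t x)) := by
  have : CompleteSpace (V →L[ℂ] V) := FiniteDimensional.complete ℂ _
  have h := tendsto_pow_exp_of_second_order (A := V →L[ℂ] V) ContinuousLinearMap.norm_id_le
    ((t : ℂ) • L.clm) (((t : ℂ) ^ 2) • B.clm)
  rw [expMap_eq_exp]
  have h2 := ((ContinuousLinearMap.apply ℂ V x).continuous.tendsto _).comp h
  refine h2.congr fun N => ?_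
  have e : (1 + ((N : ℂ)⁻¹) • (t : ℂ) • L.clm + ((N : ℂ)⁻¹) ^ 2 • ((t : ℂ) ^ 2) • B.clm) =
      (1 + ((t / N : ℝ) : ℂ) • L + ((t / N : ℝ) : ℂ) ^ 2 • B : Module.End ℂ V).clm := by
    simp only [Module.End.clm, map_add, map_smul, map_one, smul_smul]
    push_cast
    rw [div_eq_inv_mul, mul_pow]
  simp only [Function.comp_apply, ContinuousLinearMap.apply_apply]
  rw [e, Module.End.clm, ← map_pow]
  rfl

/-- The scalar part factors out as `e^{tz}`, and the series of `L - z` stops because that operator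
is nilpotent on `x`. -/
theorem expMap_genEigenvector (L : Module.End ℂ V) (z : ℂ) (d : ℕ) (x : V)
    (hx : ((L - z • 1) ^ d) x = 0) (t : ℝ) :
    expMap L t x = Complex.exp (t * z) •
      ∑ k ∈ Finset.range d, ((t : ℂ) ^ k / (k.factorial : ℂ)) • ((L - z • 1) ^ k) x := by
  have : CompleteSpace (V →L[ℂ] V) := FiniteDimensional.complete ℂ _
  let +nondep : NormedAlgebra ℚ (V →L[ℂ] V) := .restrictScalars ℚ ℂ (V →L[ℂ] V)
  have hL : (t : ℂ) • L.clm = algebraMap ℂ (V →L[ℂ] V) (t * z) + (t : ℂ) • (L - z • 1).clm := by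
    simp only [Module.End.clm, map_sub, map_smul, map_one, Algebra.algebraMap_eq_smul_one, smul_sub,
      smul_smul]
    abel
  rw [expMap_eq_exp, hL, NormedSpace.exp_add_of_commute (Algebra.commutes _ _),
    ← NormedSpace.algebraMap_exp_comm, Algebra.algebraMap_eq_smul_one, smul_mul_assoc, one_mul,
    smul_apply, ← Complex.exp_eq_exp_ℂ]
  congr 1
  refine (hasSum_expMap_exp (L - z • 1) t x).unique ?_
  refine hasSum_sum_of_ne_finset_zero fun k hk => ?_
  rw [Finset.mem_range, not_lt] at hk
  obtain ⟨m, rfl⟩ := Nat.exists_eq_add_of_le' hk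
  rw [pow_add (L - z • 1), Module.End.mul_apply, hx, map_zero, smul_zero]

end ExpMap

set_option linter.unusedSectionVars false

/-! ### Bounded semigroups: spectral splitting and the peripheral projection. -/

section Peripheral

open Filter Topology

variable {V : Type} [NormedAddCommGroup V] [NormedSpace ℂ V] [FiniteDimensional ℂ V]

/-- The span of the eigenvectors with purely imaginary eigenvalue. -/
def imaginarySpan (L : Module.End ℂ V) : Submodule ℂ V :=
  Submodule.span ℂ {x | ∃ ω : ℝ, L x = (Complex.I * (ω : ℂ)) • x}

/-- The sum of the generalized eigenspaces whose eigenvalue is not purely imaginary. -/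
def decaySpace (L : Module.End ℂ V) : Submodule ℂ V :=
  ⨆ z : {z : ℂ // z.re ≠ 0}, L.maxGenEigenspace z

/-- The semigroup generated by `L` is bounded. -/
def BoundedFlow (L : Module.End ℂ V) : Prop :=
  ∃ K : ℝ, ∀ t : ℝ, 0 ≤ t → ∀ x, ‖expMap L t x‖ ≤ K * ‖x‖

theorem hasEigenvalue_of_mem_maxGenEigenspace {L : Module.End ℂ V} {z : ℂ} {x : V}
    (hx : x ∈ L.maxGenEigenspace z) (h0 : x ≠ 0) : L.HasEigenvalue z := by
  rw [Module.End.mem_maxGenEigenspace] at hx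
  obtain ⟨k, hk⟩ := hx
  by_contra hne
  rw [Module.End.hasEigenvalue_iff, not_not, Module.End.eigenspace_def] at hne
  have hinj : Function.Injective (L - z • (1 : Module.End ℂ V)) := by
    rw [← LinearMap.ker_eq_bot]; exact hne
  have : Function.Injective ((L - z • (1 : Module.End ℂ V)) ^ k) := by
    rw [Module.End.coe_pow]; exact hinj.iterate k
  exact h0 (this (hk.trans (map_zero _).symm))

theorem eigenvalue_decomp {z : ℂ} (hz : z.re = 0) : z = Complex.I * ((z.im : ℝ) : ℂ) := by
  apply Complex.ext <;> simp [hz]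

theorem expMap_eigenvector {L : Module.End ℂ V} {z : ℂ} {x : V} (hx : L x = z • x) (t : ℝ) :
    expMap L t x = Complex.exp (t * z) • x := by
  rw [expMap_genEigenvector L z 1 x (by simp [hx])]
  simp

theorem norm_expMap_imaginary {L : Module.End ℂ V} {ω : ℝ} {x : V}
    (hx : L x = (Complex.I * (ω : ℂ)) • x) (t : ℝ) (y : V) :
    expMap L t x = Complex.exp (t * (Complex.I * ω)) • x ∧
      ‖Complex.exp (t * (Complex.I * ω)) • y‖ = ‖y‖ := by
  refine ⟨expMap_eigenvector hx t, ?_⟩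
  rw [norm_smul, Complex.norm_exp]
  simp

theorem BoundedFlow.re_nonpos {L : Module.End ℂ V} (hL : BoundedFlow L) {z : ℂ}
    (hz : L.HasEigenvalue z) : z.re ≤ 0 := by
  obtain ⟨K, hK⟩ := hL
  obtain ⟨x, hx⟩ := hz.exists_hasEigenvector
  have hx0 : 0 < ‖x‖ := norm_pos_iff.2 hx.2
  by_contra! hpos
  have hb : ∀ t : ℝ, 0 ≤ t → Real.exp (t * z.re) ≤ K := by
    intro t ht
    have := hK t ht x
    rw [expMap_eigenvector hx.apply_eq_smul, norm_smul, Complex.norm_exp] at this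
    simpa using le_of_mul_le_mul_right this hx0
  have hK0 := hb 0 le_rfl
  simp only [zero_mul, Real.exp_zero] at hK0
  -- This time turns the bound into `e^K ≤ K`.
  have h1 := hb (K / z.re) (div_nonneg (by linarith) hpos.le)
  rw [div_mul_cancel₀ _ hpos.ne'] at h1
  linarith [Real.add_one_le_exp K]

/-- With `y = (L - z) x` the orbit is `e^{tz} (x + t y)`, where `|e^{tz}| = 1`; it grows linearly
unless `y = 0`. -/
theorem BoundedFlow.eigenvector_of_sq {L : Module.End ℂ V} (hL : BoundedFlow L) {z : ℂ}
    (hz : z.re = 0) {x : V} (hx : ((L - z • (1 : Module.End ℂ V)) ^ 2) x = 0) :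
    (L - z • (1 : Module.End ℂ V)) x = 0 := by
  obtain ⟨K, hK⟩ := hL
  by_contra hne
  set y := (L - z • (1 : Module.End ℂ V)) x with hy
  have hy0 : 0 < ‖y‖ := norm_pos_iff.2 hne
  have hb : ∀ t : ℝ, 0 ≤ t → ‖x + (t : ℂ) • y‖ ≤ K * ‖x‖ := by
    intro t ht
    have := hK t ht x
    rw [expMap_genEigenvector L z 2 x hx, norm_smul, Complex.norm_exp] at this
    simpa [Finset.sum_range_succ, hz, ← hy] using this
  have hb' : ∀ t : ℝ, 0 ≤ t → t * ‖y‖ ≤ K * ‖x‖ + ‖x‖ := by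
    intro t ht
    have e : t * ‖y‖ = ‖(t : ℂ) • y‖ := by
      rw [norm_smul, Complex.norm_real, Real.norm_of_nonneg ht]
    have : (t : ℂ) • y = (x + (t : ℂ) • y) - x := by abel
    rw [e, this]
    exact (norm_sub_le _ _).trans (add_le_add_left (hb t ht) _)
  have h0 : 0 ≤ K * ‖x‖ + ‖x‖ := by simpa using hb' 0 le_rfl
  have h1 := hb' ((K * ‖x‖ + ‖x‖ + 1) / ‖y‖) (by positivity)
  rw [div_mul_cancel₀ _ hy0.ne'] at h1
  linarith

theorem BoundedFlow.maxGenEigenspace_le {L : Module.End ℂ V} (hL : BoundedFlow L) {z : ℂ}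
    (hz : z.re = 0) {x : V} (hx : x ∈ L.maxGenEigenspace z) : L x = z • x := by
  rw [Module.End.mem_maxGenEigenspace] at hx
  obtain ⟨k, hk⟩ := hx
  have key : ∀ k : ℕ, ∀ x, ((L - z • (1 : Module.End ℂ V)) ^ k) x = 0 →
      (L - z • (1 : Module.End ℂ V)) x = 0 := by
    intro k
    induction k with
    | zero => intro x hx; simp only [pow_zero, Module.End.one_apply] at hx; simp [hx]
    | succ k ih =>
      intro x hx
      rw [pow_succ, Module.End.mul_apply] at hx
      refine hL.eigenvector_of_sq hz ?_
      rw [pow_two, Module.End.mul_apply]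
      exact ih _ hx
  have := key k x hk
  simpa [sub_eq_zero] using this

theorem BoundedFlow.sup_eq_top {L : Module.End ℂ V} (hL : BoundedFlow L) :
    imaginarySpan L ⊔ decaySpace L = ⊤ := by
  rw [eq_top_iff, ← Module.End.iSup_maxGenEigenspace_eq_top L, iSup_le_iff]
  intro z
  by_cases hz : z.re = 0
  · refine le_trans (fun x hx => ?_) le_sup_left
    refine Submodule.subset_span ⟨z.im, ?_⟩
    rw [← eigenvalue_decomp hz]
    exact hL.maxGenEigenspace_le hz hx
  · exact le_trans (le_iSup (fun z : {z : ℂ // z.re ≠ 0} => L.maxGenEigenspace z) ⟨z, hz⟩)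
      le_sup_right

theorem BoundedFlow.exists_add {L : Module.End ℂ V} (hL : BoundedFlow L) (x : V) :
    ∃ c ∈ imaginarySpan L, ∃ d ∈ decaySpace L, c + d = x := by
  have : x ∈ imaginarySpan L ⊔ decaySpace L := by rw [hL.sup_eq_top]; trivial
  exact Submodule.mem_sup.1 this

theorem eq_zero_of_mem_imaginarySpan_of_mem_maxGenEigenspace {L : Module.End ℂ V} {z : ℂ}
    (hz : z.re ≠ 0) {x : V} (hx : x ∈ imaginarySpan L) (hx' : x ∈ L.maxGenEigenspace z) : x = 0 := by
  have h := (Module.End.independent_maxGenEigenspace L) z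
  refine (Submodule.disjoint_def.1 h) x hx' ?_
  refine (Submodule.span_le.2 ?_) hx
  rintro y ⟨ω, hy⟩
  have hne : Complex.I * (ω : ℂ) ≠ z := by
    rintro rfl; simp at hz
  refine (le_iSup₂ (f := fun (w : ℂ) (_ : w ≠ z) => L.maxGenEigenspace w) _ hne) ?_
  rw [Module.End.mem_maxGenEigenspace]
  exact ⟨1, by simp [hy]⟩

/-- Commuting with `L`, the map `P` preserves each generalized eigenspace, but its values lie in the
span of the imaginary ones, and generalized eigenspaces are independent. -/
theorem apply_eq_zero_of_mem_decaySpace {L P : Module.End ℂ V} (hc : P * L = L * P)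
    (hr : LinearMap.range P = imaginarySpan L) {x : V} (hx : x ∈ decaySpace L) : P x = 0 := by
  refine Submodule.iSup_induction _ (motive := fun x => P x = 0) hx ?_ (map_zero _) ?_
  · rintro ⟨z, hz⟩ y hy
    have h1 : P y ∈ L.maxGenEigenspace z :=
      Module.End.mapsTo_maxGenEigenspace_of_comm (show Commute L P from hc.symm) z hy
    have h2 : P y ∈ imaginarySpan L := by rw [← hr]; exact ⟨y, rfl⟩
    exact eq_zero_of_mem_imaginarySpan_of_mem_maxGenEigenspace hz h2 h1
  · intro y y' h h'
    rw [map_add, h, h', add_zero]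

theorem apply_eq_self_of_mem_range {P : Module.End ℂ V} (hi : P * P = P) {x : V}
    (hx : x ∈ LinearMap.range P) : P x = x := by
  obtain ⟨y, rfl⟩ := hx
  rw [← Module.End.mul_apply, hi]

/-- Range and commutation already force the kernel to contain the decay space; positivity plays no
role. -/
theorem BoundedFlow.projection_unique {L P Q : Module.End ℂ V} (hL : BoundedFlow L)
    (hP : P * L = L * P) (hPr : LinearMap.range P = imaginarySpan L) (hPi : P * P = P)
    (hQ : Q * L = L * Q) (hQr : LinearMap.range Q = imaginarySpan L) (hQi : Q * Q = Q) :
    P = Q := by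
  ext x
  obtain ⟨c, hc, d, hd, rfl⟩ := hL.exists_add x
  rw [map_add, map_add, apply_eq_zero_of_mem_decaySpace hP hPr hd,
    apply_eq_zero_of_mem_decaySpace hQ hQr hd, apply_eq_self_of_mem_range hPi (hPr ▸ hc),
    apply_eq_self_of_mem_range hQi (hQr ▸ hc)]

theorem BoundedFlow.sub_mem_decaySpace {L P : Module.End ℂ V} (hL : BoundedFlow L)
    (hP : P * L = L * P) (hPr : LinearMap.range P = imaginarySpan L) (hPi : P * P = P) (x : V) :
    x - P x ∈ decaySpace L := by
  obtain ⟨c, hc, d, hd, rfl⟩ := hL.exists_add x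
  rw [map_add, apply_eq_zero_of_mem_decaySpace hP hPr hd, apply_eq_self_of_mem_range hPi (hPr ▸ hc)]
  simpa using hd

theorem decaySpace_eq_bot {L : Module.End ℂ V} (h : ∀ z, L.HasEigenvalue z → z.re = 0) :
    decaySpace L = ⊥ := by
  rw [decaySpace, iSup_eq_bot]
  rintro ⟨z, hz⟩
  rw [Submodule.eq_bot_iff]
  intro x hx
  by_contra h0
  exact hz (h z (hasEigenvalue_of_mem_maxGenEigenspace hx h0))

/-- Decaying eigenvalues may have Jordan blocks; their polynomial factors are absorbed by the loss
`δ` in the rate, through `(δ t)^k / k! ≤ e^{δ t}`. -/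
theorem sum_pow_div_factorial_le {δ : ℝ} (hδ : 0 < δ) (d : ℕ) (c : ℕ → ℝ) (hc : ∀ k, 0 ≤ c k)
    {t : ℝ} (ht : 0 ≤ t) :
    ∑ k ∈ Finset.range d, t ^ k / k.factorial * c k ≤
      (∑ k ∈ Finset.range d, c k / δ ^ k) * Real.exp (δ * t) := by
  rw [Finset.sum_mul]
  refine Finset.sum_le_sum fun k _ => ?_
  have h1 : (δ * t) ^ k / k.factorial ≤ Real.exp (δ * t) :=
    Real.pow_div_factorial_le_exp _ (by positivity) k
  calc t ^ k / k.factorial * c k = c k / δ ^ k * ((δ * t) ^ k / k.factorial) := by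
        rw [mul_pow]; field_simp
    _ ≤ _ := mul_le_mul_of_nonneg_left h1 (div_nonneg (hc k) (by positivity))

theorem BoundedFlow.seminorm_expMap_le {L : Module.End ℂ V} (hL : BoundedFlow L) (N : Seminorm ℂ V)
    {Δ : ℝ} (hΔ : ∀ z, L.HasEigenvalue z → z.re ≠ 0 → Δ ≤ |z.re|) {δ : ℝ} (hδ : 0 < δ) {x : V}
    (hx : x ∈ decaySpace L) :
    ∃ Γ : ℝ, 0 < Γ ∧ ∀ t : ℝ, 0 ≤ t → N (expMap L t x) ≤ Γ * Real.exp (-(Δ - δ) * t) := by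
  refine Submodule.iSup_induction _ (motive := fun x => ∃ Γ : ℝ, 0 < Γ ∧ ∀ t : ℝ, 0 ≤ t →
    N (expMap L t x) ≤ Γ * Real.exp (-(Δ - δ) * t)) hx ?_ ?_ ?_
  · rintro ⟨z, hz⟩ y hy
    by_cases hy0 : y = 0
    · subst hy0
      refine ⟨1, one_pos, fun t _ => ?_⟩
      rw [expMap_eq_exp, map_zero, map_zero]
      positivity
    have hev := hasEigenvalue_of_mem_maxGenEigenspace hy hy0
    have hneg := hL.re_nonpos hev
    have hle := hΔ z hev hz
    rw [abs_of_nonpos hneg] at hle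
    rw [Module.End.mem_maxGenEigenspace] at hy
    obtain ⟨d, hd⟩ := hy
    set c : ℕ → ℝ := fun k => N (((L - z • (1 : Module.End ℂ V)) ^ k) y)
    have hc : ∀ k, 0 ≤ c k := fun k => apply_nonneg N _
    set C := ∑ k ∈ Finset.range d, c k / δ ^ k
    have hC : 0 ≤ C := Finset.sum_nonneg fun k _ => div_nonneg (hc k) (by positivity)
    refine ⟨C + 1, by positivity, fun t ht => ?_⟩
    rw [expMap_genEigenvector L z d y hd, map_smul_eq_mul, Complex.norm_exp]
    have h1 : N (∑ k ∈ Finset.range d, ((t : ℂ) ^ k / (k.factorial : ℂ)) •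
        ((L - z • (1 : Module.End ℂ V)) ^ k) y) ≤ C * Real.exp (δ * t) := by
      refine le_trans ?_ (sum_pow_div_factorial_le hδ d c hc ht)
      refine (Finset.le_sum_of_subadditive N (map_zero N).le (map_add_le_add N) _ _).trans (le_of_eq (Finset.sum_congr rfl fun k _ => ?_))
      rw [map_smul_eq_mul]
      simp [abs_of_nonneg ht, c]
    have h2 : Real.exp ((t : ℂ) * z).re ≤ Real.exp (-Δ * t) := by
      rw [Real.exp_le_exp]
      simp only [Complex.mul_re, Complex.ofReal_re, Complex.ofReal_im, zero_mul, sub_zero]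
      nlinarith
    calc _ ≤ Real.exp (-Δ * t) * (C * Real.exp (δ * t)) :=
          mul_le_mul h2 h1 (apply_nonneg N _) (Real.exp_pos _).le
      _ = C * Real.exp (-(Δ - δ) * t) := by
          rw [mul_left_comm, ← Real.exp_add]; congr 2; ring
      _ ≤ _ := mul_le_mul_of_nonneg_right (by linarith) (Real.exp_pos _).le
  · refine ⟨1, one_pos, fun t _ => ?_⟩
    rw [expMap_eq_exp, map_zero, map_zero]
    positivity
  · rintro y y' ⟨Γ, hΓ, h⟩ ⟨Γ', hΓ', h'⟩
    refine ⟨Γ + Γ', by positivity, fun t ht => ?_⟩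
    rw [expMap_add, add_mul]
    exact (map_add_le_add N _ _).trans (add_le_add (h t ht) (h' t ht))

/-- Convergence needs a strictly positive rate. If no eigenvalue decays, any positive number will
do, whereas `spectralGap` is then zero. -/
theorem exists_gap (L : Module.End ℂ V) :
    ∃ Δ : ℝ, 0 < Δ ∧ ∀ z, L.HasEigenvalue z → z.re ≠ 0 → Δ ≤ |z.re| := by
  have hfin : {z : ℂ | L.HasEigenvalue z ∧ z.re ≠ 0}.Finite :=
    (Module.End.finite_hasEigenvalue L).subset fun z hz => hz.1
  rcases Set.eq_empty_or_nonempty {z : ℂ | L.HasEigenvalue z ∧ z.re ≠ 0} with h | h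
  · refine ⟨1, one_pos, fun z hz hz' => ?_⟩
    have : z ∈ {z : ℂ | L.HasEigenvalue z ∧ z.re ≠ 0} := ⟨hz, hz'⟩
    rw [h] at this
    exact this.elim
  · obtain ⟨w, hw, hmin⟩ := Set.exists_min_image _ (fun z : ℂ => |z.re|) hfin h
    exact ⟨|w.re|, abs_pos.2 hw.2, fun z hz hz' => hmin z ⟨hz, hz'⟩⟩

theorem BoundedFlow.tendsto_zero {L : Module.End ℂ V} (hL : BoundedFlow L) {x : V}
    (hx : x ∈ decaySpace L) : Tendsto (fun t : ℝ => expMap L t x) atTop (𝓝 0) := by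
  obtain ⟨Δ, hΔ0, hΔ⟩ := exists_gap L
  obtain ⟨Γ, hΓ, h⟩ := hL.seminorm_expMap_le (normSeminorm ℂ V) hΔ (half_pos hΔ0) hx
  rw [tendsto_zero_iff_norm_tendsto_zero]
  have h1 : Tendsto (fun t : ℝ => Γ * Real.exp (-(Δ - Δ / 2) * t)) atTop (𝓝 0) := by
    have : Tendsto (fun t : ℝ => -(Δ - Δ / 2) * t) atTop atBot :=
      tendsto_id.const_mul_atTop_of_neg (by linarith)
    simpa using (Real.tendsto_exp_atBot.comp this).const_mul Γ
  refine tendsto_of_tendsto_of_tendsto_of_le_of_le' tendsto_const_nhds h1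
    (Eventually.of_forall fun _ => norm_nonneg _) ?_
  filter_upwards [eventually_ge_atTop 0] with t ht using h t ht

/-- The projection is an actual limit of flow maps, so that closed properties such as complete
positivity pass to it. If `e^{φ(k) L}` converges, the times `φ(2k) - φ(k)` tend to infinity, which
kills the decaying part, while on the imaginary eigenvectors the flow at these times tends to the
identity. -/
theorem BoundedFlow.exists_projection {L : Module.End ℂ V} (hL : BoundedFlow L) :
    ∃ (Q : Module.End ℂ V) (m : ℕ → ℕ),
      (∀ x, Tendsto (fun k => expMap L (m k) x) atTop (𝓝 (Q x))) ∧ Q * Q = Q ∧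
      LinearMap.range Q = imaginarySpan L ∧ Q * L = L * Q := by
  obtain ⟨K, hK⟩ := id hL
  set E : ℕ → V →L[ℂ] V := fun m => NormedSpace.exp (((m : ℝ) : ℂ) • L.clm)
  have hE : ∀ m x, E m x = expMap L (m : ℝ) x := fun m x => (expMap_eq_exp L m x).symm
  have hmem : ∀ m, E m ∈ Metric.closedBall (0 : V →L[ℂ] V) (max K 0) := by
    intro m
    rw [mem_closedBall_zero_iff]
    refine ContinuousLinearMap.opNorm_le_bound _ (le_max_right _ _) fun x => ?_
    rw [hE]
    exact (hK _ (Nat.cast_nonneg m) x).trans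
      (mul_le_mul_of_nonneg_right (le_max_left _ _) (norm_nonneg _))
  have : ProperSpace (V →L[ℂ] V) := FiniteDimensional.proper ℂ _
  obtain ⟨S, -, φ, hφ, hS⟩ := (isCompact_closedBall (0 : V →L[ℂ] V) (max K 0)).tendsto_subseq hmem
  set ψ : ℕ → ℕ := fun k => φ (2 * k) - φ k
  have hψ : ∀ k, k ≤ ψ k := by
    intro k
    have := hφ.add_le_nat k k
    rw [← two_mul] at this
    simp only [ψ]; omega
  -- A second extraction makes the flow at the difference times converge on the whole space.
  obtain ⟨Q, -, θ, hθ, hQ⟩ := (isCompact_closedBall (0 : V →L[ℂ] V) (max K 0)).tendsto_subseq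
    (fun k => hmem (ψ k))
  have hQx : ∀ x, Tendsto (fun k => expMap L (ψ (θ k) : ℕ) x) atTop (𝓝 (Q x)) := by
    intro x
    have := ((ContinuousLinearMap.apply ℂ V x).continuous.tendsto _).comp hQ
    exact this.congr fun k => hE _ _
  have hψt : Tendsto (fun k => ((ψ (θ k) : ℕ) : ℝ)) atTop atTop := by
    refine tendsto_natCast_atTop_atTop.comp (tendsto_atTop_mono (fun k => hψ _) hθ.tendsto_atTop)
  have hdec : ∀ x ∈ decaySpace L, Q x = 0 := fun x hx =>
    tendsto_nhds_unique (hQx x) ((hL.tendsto_zero hx).comp hψt)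
  have him : ∀ x ∈ imaginarySpan L, Q x = x := by
    intro x hx
    have : imaginarySpan L ≤ LinearMap.eqLocus (Q : V →ₗ[ℂ] V) LinearMap.id := by
      refine Submodule.span_le.2 ?_
      rintro y ⟨ω, hy⟩
      change Q y = y
      have h1 : Tendsto (fun k => E (φ (2 * k)) y - E (φ k) y) atTop (𝓝 0) := by
        have a1 := ((ContinuousLinearMap.apply ℂ V y).continuous.tendsto _).comp hS
        have a2 := a1.comp (tendsto_id.const_mul_atTop' (show 0 < 2 by norm_num))
        simpa using a2.sub a1
      -- Multiplying by the unimodular factor of time `φ k` turns the defect at time `ψ k` into the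
      -- difference of two terms of a convergent sequence.
      have h2 : ∀ k, ‖expMap L (ψ k : ℕ) y - y‖ = ‖E (φ (2 * k)) y - E (φ k) y‖ := by
        intro k
        have hle : φ k ≤ φ (2 * k) := hφ.monotone (by omega)
        rw [hE, hE, (norm_expMap_imaginary hy _ y).1, (norm_expMap_imaginary hy _ y).1,
          (norm_expMap_imaginary hy _ y).1,
          ← (norm_expMap_imaginary hy (φ k : ℕ) (Complex.exp _ • y - y)).2, smul_sub, smul_smul,
          ← Complex.exp_add]
        congr 4
        simp only [ψ]
        push_cast [Nat.cast_sub hle]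
        ring_nf
      have h3 : Tendsto (fun k => expMap L (ψ k : ℕ) y - y) atTop (𝓝 0) := by
        rw [tendsto_zero_iff_norm_tendsto_zero] at h1 ⊢
        exact h1.congr fun k => (h2 k).symm
      have h4 := (h3.comp hθ.tendsto_atTop).add_const y
      simp only [Function.comp_apply, sub_add_cancel, zero_add] at h4
      exact tendsto_nhds_unique (hQx y) h4
    exact this hx
  have hQmem : ∀ x, Q x ∈ imaginarySpan L := by
    intro x
    obtain ⟨c, hc, d, hd, rfl⟩ := hL.exists_add x
    rw [map_add, hdec d hd, him c hc, add_zero]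
    exact hc
  refine ⟨Q, fun k => ψ (θ k), hQx, ?_, ?_, ?_⟩
  · ext x
    exact him _ (hQmem x)
  · refine le_antisymm ?_ fun x hx => ⟨x, him x hx⟩
    rintro _ ⟨x, rfl⟩
    exact hQmem x
  · ext x
    change Q (L x) = L (Q x)
    have h1 := hQx (L x)
    have h2 := (L.clm.continuous.tendsto _).comp (hQx x)
    refine tendsto_nhds_unique h1 (h2.congr fun k => ?_)
    exact (expMap_intertwine L L L (fun _ => rfl) _ x).symm

end Peripheral

/-! ### Kraus maps and Choi matrices. -/

section Kraus

open Matrix Filter Topology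

variable {n : ℕ}

theorem Matrix.PosSemidef.exists_conjTranspose_mul_self {m : Type*} [Fintype m]
    {A : Matrix m m ℂ} (hA : A.PosSemidef) : ∃ B : Matrix m m ℂ, A = Bᴴ * B := by
  classical
  open scoped MatrixOrder in
  exact CStarAlgebra.nonneg_iff_eq_star_mul_self.mp hA.nonneg

/-- `Φ` has a Kraus representation. -/
def IsKraus (Φ : SuperOp n) : Prop :=
  ∃ (ι : Type) (_ : Fintype ι) (M : ι → Op n), ∀ X, Φ X = ∑ a, M a * X * (M a)ᴴ

theorem IsKraus.one : IsKraus (1 : SuperOp n) :=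
  ⟨Unit, inferInstance, fun _ => 1, fun X => by simp⟩

theorem IsKraus.mul {Φ Ψ : SuperOp n} (hΦ : IsKraus Φ) (hΨ : IsKraus Ψ) : IsKraus (Φ * Ψ) := by
  obtain ⟨ι, _, M, hM⟩ := hΦ
  obtain ⟨κ, _, M', hM'⟩ := hΨ
  refine ⟨ι × κ, inferInstance, fun p => M p.1 * M' p.2, fun X => ?_⟩
  rw [Module.End.mul_apply, hM, hM', Fintype.sum_prod_type]
  refine Finset.sum_congr rfl fun a _ => ?_
  rw [Finset.mul_sum, Finset.sum_mul]
  refine Finset.sum_congr rfl fun b _ => ?_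
  simp only [conjTranspose_mul, Matrix.mul_assoc]

theorem IsKraus.pow {Φ : SuperOp n} (hΦ : IsKraus Φ) (k : ℕ) : IsKraus (Φ ^ k) := by
  induction k with
  | zero => exact IsKraus.one
  | succ k ih => rw [pow_succ]; exact ih.mul hΦ

/-- The Choi matrix of a super-operator. -/
def choi (Φ : SuperOp n) : Matrix (Fin n × Fin n) (Fin n × Fin n) ℂ :=
  Matrix.of fun p q => Φ (Matrix.single p.1 q.1 1) p.2 q.2

theorem mul_single_mul_conjTranspose_apply (M : Op n) (i j a b : Fin n) :
    (M * Matrix.single i j (1 : ℂ) * Mᴴ : Op n) a b = M a i * star (M b j) := by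
  rw [Matrix.mul_apply, Finset.sum_eq_single j]
  · rw [mul_single_apply_same, conjTranspose_apply, mul_one]
  · intro k _ hk
    rw [mul_single_apply_of_ne _ _ _ _ _ hk, zero_mul]
  · simp

theorem superOp_apply_apply (Φ : SuperOp n) (X : Op n) (a b : Fin n) :
    Φ X a b = ∑ i, ∑ j, X i j * Φ (Matrix.single i j 1) a b := by
  conv_lhs => rw [matrix_eq_sum_single X]
  simp only [map_sum, Matrix.sum_apply]
  refine Finset.sum_congr rfl fun i _ => Finset.sum_congr rfl fun j _ => ?_
  have : Matrix.single i j (X i j) = X i j • Matrix.single i j (1 : ℂ) := by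
    rw [smul_single, smul_eq_mul, mul_one]
  rw [this, map_smul, Matrix.smul_apply, smul_eq_mul]

/-- Kraus operators are the reshaped rows of a factor `B` with `choi Φ = B† B`. Unlike a Kraus
family, whose index set may vary, the Choi matrix has fixed size, so positivity can be passed to
limits. -/
theorem isKraus_iff_choi (Φ : SuperOp n) : IsKraus Φ ↔ (choi Φ).PosSemidef := by
  constructor
  · rintro ⟨ι, _, M, hM⟩
    have : choi Φ = (Matrix.of fun (p : Fin n × Fin n) (a : ι) => M a p.2 p.1) *
        (Matrix.of fun (p : Fin n × Fin n) (a : ι) => M a p.2 p.1)ᴴ := by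
      ext p q
      simp only [choi, of_apply, hM, Matrix.sum_apply, mul_single_mul_conjTranspose_apply,
        Matrix.mul_apply (M := Matrix.of _), conjTranspose_apply]
    rw [this]
    exact posSemidef_self_mul_conjTranspose _
  · intro h
    obtain ⟨B, hB⟩ := h.exists_conjTranspose_mul_self
    refine ⟨Fin n × Fin n, inferInstance, fun r => Matrix.of fun a i => star (B r (i, a)),
      fun X => ?_⟩
    ext a b
    rw [superOp_apply_apply, Matrix.sum_apply]
    have h1 : ∀ i j, Φ (Matrix.single i j 1) a b = ∑ r, star (B r (i, a)) * B r (j, b) := by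
      intro i j
      have : choi Φ (i, a) (j, b) = (Bᴴ * B) (i, a) (j, b) := by rw [hB]
      simpa [choi, Matrix.mul_apply] using this
    simp only [h1, Finset.mul_sum]
    rw [Finset.sum_congr rfl fun i _ => Finset.sum_comm, Finset.sum_comm]
    refine Finset.sum_congr rfl fun r _ => ?_
    simp only [Matrix.mul_apply, conjTranspose_apply, of_apply, star_star, Finset.sum_mul]
    rw [Finset.sum_comm]
    refine Finset.sum_congr rfl fun j _ => Finset.sum_congr rfl fun i _ => ?_
    ring

theorem posSemidef_of_tendsto {m : Type*} [Fintype m] {A : ℕ → Matrix m m ℂ} {B : Matrix m m ℂ}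
    (hA : ∀ k, (A k).PosSemidef) (h : ∀ p q, Tendsto (fun k => A k p q) atTop (𝓝 (B p q))) :
    B.PosSemidef := by
  rw [posSemidef_iff_dotProduct_mulVec]
  constructor
  · ext p q
    rw [conjTranspose_apply]
    refine tendsto_nhds_unique ((continuous_star.tendsto _).comp (h q p)) ((h p q).congr fun k => ?_)
    exact ((hA k).isHermitian.apply p q).symm
  · intro x
    have ht : Tendsto (fun k => star x ⬝ᵥ (A k *ᵥ x)) atTop (𝓝 (star x ⬝ᵥ (B *ᵥ x))) := by
      simp only [dotProduct, mulVec]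
      exact tendsto_finsetSum _ fun p _ => (tendsto_finsetSum _ fun q _ =>
        (h p q).mul_const _).const_mul _
    exact ge_of_tendsto' ht fun k => (hA k).dotProduct_mulVec_nonneg x

theorem IsKraus.of_tendsto {Φ : ℕ → SuperOp n} {Ψ : SuperOp n} (hΦ : ∀ k, IsKraus (Φ k))
    (h : ∀ X, Tendsto (fun k => Φ k X) atTop (𝓝 (Ψ X))) : IsKraus Ψ := by
  rw [isKraus_iff_choi]
  refine posSemidef_of_tendsto (fun k => (isKraus_iff_choi _).1 (hΦ k)) fun p q => ?_
  exact tendsto_pi_nhds.1 (tendsto_pi_nhds.1 (h (Matrix.single p.1 q.1 1)) p.2) q.2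

theorem sum_conjTranspose_mul_self_eq_one {Φ : SuperOp n} {ι : Type} [Fintype ι] {M : ι → Op n}
    (hM : ∀ X, Φ X = ∑ a, M a * X * (M a)ᴴ) (hΦ : ∀ X, (Φ X).trace = X.trace) :
    ∑ a, (M a)ᴴ * M a = 1 := by
  rw [ext_iff_trace_mul_left]
  intro X
  rw [Matrix.mul_one, ← hΦ X, hM, Finset.mul_sum, trace_sum, trace_sum]
  refine Finset.sum_congr rfl fun a _ => ?_
  rw [← Matrix.mul_assoc, trace_mul_comm, ← Matrix.mul_assoc]

/-- Since `∑ M† M = 1`, the `i`-th columns of all Kraus operators stacked together form a unit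
vector; the entry is a partial inner product of two such vectors. The bound does not depend on the
map, which is what makes the flow uniformly bounded in time. -/
theorem IsKraus.norm_apply_single_le {Φ : SuperOp n} (hK : IsKraus Φ)
    (hΦ : ∀ X, (Φ X).trace = X.trace) (i j a b : Fin n) :
    ‖Φ (Matrix.single i j 1) a b‖ ≤ 1 := by
  obtain ⟨ι, _, M, hM⟩ := hK
  have h1 := sum_conjTranspose_mul_self_eq_one hM hΦ
  have hcol : ∀ i a, ∑ r, ‖M r a i‖ ^ 2 ≤ 1 := by
    intro i a
    have h2 : (∑ r, (M r)ᴴ * M r) i i = 1 := by rw [h1]; simp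
    have h3 : (((∑ r, ∑ a, ‖M r a i‖ ^ 2 : ℝ)) : ℂ) = 1 := by
      rw [← h2]
      simp only [Matrix.sum_apply, Matrix.mul_apply, conjTranspose_apply, Complex.ofReal_sum]
      refine Finset.sum_congr rfl fun r _ => Finset.sum_congr rfl fun c _ => ?_
      rw [Complex.star_def, Complex.conj_mul']
      push_cast; rfl
    have h4 : (∑ r, ∑ a, ‖M r a i‖ ^ 2 : ℝ) = 1 := by exact_mod_cast h3
    rw [← h4]
    exact Finset.sum_le_sum fun r _ =>
      Finset.single_le_sum (f := fun a => ‖M r a i‖ ^ 2) (fun _ _ => by positivity) (Finset.mem_univ a)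
  rw [hM, Matrix.sum_apply]
  simp only [mul_single_mul_conjTranspose_apply]
  refine (norm_sum_le _ _).trans ?_
  calc ∑ r, ‖M r a i * star (M r b j)‖ ≤ ∑ r, (‖M r a i‖ ^ 2 + ‖M r b j‖ ^ 2) / 2 := by
        refine Finset.sum_le_sum fun r _ => ?_
        rw [norm_mul, norm_star]
        nlinarith [sq_nonneg (‖M r a i‖ - ‖M r b j‖)]
    _ = ((∑ r, ‖M r a i‖ ^ 2) + ∑ r, ‖M r b j‖ ^ 2) / 2 := by
        rw [← Finset.sum_add_distrib, Finset.sum_div]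
    _ ≤ 1 := by linarith [hcol i a, hcol j b]

end Kraus

/-! ### Lindblad flows are bounded Kraus flows. -/

section Lindblad

open Matrix Filter Topology

attribute [local instance] Matrix.normedAddCommGroup Matrix.normedSpace

variable {n : ℕ}

theorem IsKraus.norm_apply_le {Φ : SuperOp n} (hK : IsKraus Φ)
    (hΦ : ∀ X, (Φ X).trace = X.trace) (X : Op n) : ‖Φ X‖ ≤ (n * n : ℝ) * ‖X‖ := by
  rw [Matrix.norm_le_iff (by positivity)]
  intro a b
  rw [superOp_apply_apply]
  calc _ ≤ ∑ i : Fin n, ∑ j : Fin n, ‖X‖ := by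
        refine (norm_sum_le _ _).trans (Finset.sum_le_sum fun i _ => (norm_sum_le _ _).trans
          (Finset.sum_le_sum fun j _ => ?_))
        rw [norm_mul]
        calc _ ≤ ‖X‖ * 1 := mul_le_mul (norm_entry_le_entrywise_sup_norm X)
              (hK.norm_apply_single_le hΦ i j a b) (norm_nonneg _) (norm_nonneg _)
          _ = _ := mul_one _
    _ = _ := by simp [mul_assoc]

theorem lindblad_trace {L : SuperOp n} (hL : IsLindbladGenerator L) (X : Op n) :
    (L X).trace = 0 := by
  obtain ⟨H, m, V, -, h⟩ := hL
  rw [h, trace_add, trace_neg, trace_smul, trace_sub, trace_mul_comm H X, sub_self, smul_zero,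
    neg_zero, zero_add, trace_sum]
  refine Finset.sum_eq_zero fun k _ => ?_
  rw [trace_sub, trace_smul, trace_add, trace_mul_comm X, trace_mul_cycle (V k) X, ← two_smul ℂ,
    smul_smul]
  norm_num

/-- The effective non-Hermitian generator of the jump-free evolution. -/
theorem lindblad_effective {L : SuperOp n} (hL : IsLindbladGenerator L) :
    ∃ (G : Op n) (m : ℕ) (V : Fin m → Op n),
      ∀ X, L X = G * X + X * Gᴴ + ∑ k, V k * X * (V k)ᴴ := by
  obtain ⟨H, m, V, hH, h⟩ := hL
  refine ⟨-(Complex.I • H) - (1 / 2 : ℂ) • ∑ k, (V k)ᴴ * V k, m, V, fun X => ?_⟩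
  rw [h, Finset.sum_sub_distrib, ← Finset.smul_sum, Finset.sum_add_distrib, ← Finset.sum_mul,
    ← Finset.mul_sum]
  have hS : (∑ k, (V k)ᴴ * V k)ᴴ = ∑ k, (V k)ᴴ * V k := by
    simp [conjTranspose_sum]
  have h2 : star (1 / 2 : ℂ) = 1 / 2 := by simp
  rw [conjTranspose_sub, conjTranspose_neg, conjTranspose_smul, conjTranspose_smul, hS, hH.eq, h2,
    Complex.star_def, Complex.conj_I]
  simp only [sub_mul, mul_sub, neg_mul, smul_mul_assoc, mul_smul_comm, neg_smul, neg_neg,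
    smul_sub, smul_add]
  abel

/-- The term `ε² G X G†` completes the square: `1 + ε L + ε² B` has Kraus operators `1 + ε G` and
`√ε V k` with no remainder. -/
theorem lindblad_isKraus_expMap {L : SuperOp n} (hL : IsLindbladGenerator L) {t : ℝ} (ht : 0 ≤ t)
    {Ψ : SuperOp n} (hΨ : ∀ X, Ψ X = expMap L t X) : IsKraus Ψ := by
  obtain ⟨G, m, V, h⟩ := lindblad_effective hL
  let B : SuperOp n := LinearMap.mulLeft ℂ G * LinearMap.mulRight ℂ Gᴴ
  have hB : ∀ X, B X = G * X * Gᴴ := fun X => by simp [B, Matrix.mul_assoc]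
  have hstep : ∀ ε : ℝ, 0 ≤ ε → IsKraus (1 + (ε : ℂ) • L + (ε : ℂ) ^ 2 • B : SuperOp n) := by
    intro ε hε
    refine ⟨Option (Fin m), inferInstance,
      fun o => o.elim (1 + (ε : ℂ) • G) fun k => ((Real.sqrt ε : ℝ) : ℂ) • V k, fun X => ?_⟩
    rw [Fintype.sum_option]
    have hsq : ∀ k, (((Real.sqrt ε : ℝ) : ℂ) • V k) * X * (((Real.sqrt ε : ℝ) : ℂ) • V k)ᴴ =
        (ε : ℂ) • (V k * X * (V k)ᴴ) := by
      intro k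
      rw [conjTranspose_smul, Complex.star_def, Complex.conj_ofReal, smul_mul_assoc, smul_mul_assoc,
        mul_smul_comm, smul_smul, ← Complex.ofReal_mul, Real.mul_self_sqrt hε]
    simp only [Option.elim_none, Option.elim_some, hsq, ← Finset.smul_sum]
    simp only [LinearMap.add_apply, LinearMap.smul_apply, Module.End.one_apply, h, hB,
      conjTranspose_add, conjTranspose_one, conjTranspose_smul, Complex.star_def,
      Complex.conj_ofReal, add_mul, mul_add, smul_add, smul_mul_assoc, mul_smul_comm, smul_smul,
      one_mul, mul_one, pow_two]
    abel
  have htend : ∀ X, Tendsto (fun N : ℕ => ((1 + ((t / N : ℝ) : ℂ) • L +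
      ((t / N : ℝ) : ℂ) ^ 2 • B : SuperOp n) ^ N) X) atTop (𝓝 (Ψ X)) := by
    intro X
    rw [hΨ]
    exact tendsto_pow_expMap (V := Op n) L B t X
  exact IsKraus.of_tendsto (fun N => (hstep _ (by positivity)).pow N) htend

theorem lindblad_trace_expMap {L : SuperOp n} (hL : IsLindbladGenerator L) (t : ℝ) (X : Op n) :
    (expMap L t X).trace = X.trace := by
  have h := (hasSum_expMap (V := Op n) L t X).mapL
    (LinearMap.toContinuousLinearMap (Matrix.traceLinearMap (Fin n) ℂ ℂ))
  refine h.unique ?_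
  have : X.trace = (LinearMap.toContinuousLinearMap (Matrix.traceLinearMap (Fin n) ℂ ℂ))
      (((t : ℂ) ^ 0 / (Nat.factorial 0 : ℂ)) • (L ^ 0) X) := by simp
  rw [this]
  refine hasSum_single 0 fun k hk => ?_
  obtain ⟨k, rfl⟩ := Nat.exists_eq_succ_of_ne_zero hk
  rw [pow_succ' L]
  simp [lindblad_trace hL]

theorem lindblad_boundedFlow {L : SuperOp n} (hL : IsLindbladGenerator L) :
    BoundedFlow (V := Op n) L := by
  refine ⟨n * n, fun t ht X => ?_⟩
  obtain ⟨Ψ, hΨ⟩ := exists_end_eq_expMap (V := Op n) L t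
  have h1 := lindblad_isKraus_expMap hL ht hΨ
  have h2 := h1.norm_apply_le (fun X => by rw [hΨ]; exact lindblad_trace_expMap hL t X) X
  rw [hΨ] at h2
  exact h2

theorem lindblad_exists_projection {L : SuperOp n} (hL : IsLindbladGenerator L) :
    ∃ Q : SuperOp n, IsKraus Q ∧ (∀ X, (Q X).trace = X.trace) ∧ Q * Q = Q ∧
      LinearMap.range Q = centerManifold L ∧ Q * L = L * Q := by
  obtain ⟨Q, m, hQ, h1, h2, h3⟩ := (lindblad_boundedFlow hL).exists_projection
  refine ⟨Q, ?_, fun X => ?_, h1, h2, h3⟩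
  · choose Ψ hΨ using fun k => exists_end_eq_expMap (V := Op n) L (m k)
    refine IsKraus.of_tendsto (Φ := Ψ)
      (fun k => lindblad_isKraus_expMap hL (Nat.cast_nonneg _) (hΨ k)) fun X => ?_
    exact (hQ X).congr fun k => (hΨ k X).symm
  · have h := ((LinearMap.toContinuousLinearMap (Matrix.traceLinearMap (Fin n) ℂ ℂ)).continuous.tendsto
      _).comp (hQ X)
    refine tendsto_nhds_unique h (tendsto_const_nhds.congr fun k => ?_)
    exact (lindblad_trace_expMap hL _ X).symm

end Lindblad

/-! ### Block decomposition of a `*`-closed matrix algebra. -/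

section Wedderburn

open Matrix

variable {n : ℕ}

theorem Matrix.IsHermitian.exists_unitary_diagonal {A : Op n} (hA : A.IsHermitian) :
    ∃ (U : Op n) (d : Fin n → ℝ), Uᴴ * U = 1 ∧ U * Uᴴ = 1 ∧
      A = U * diagonal (fun i => (d i : ℂ)) * Uᴴ := by
  refine ⟨hA.eigenvectorUnitary, hA.eigenvalues, ?_, ?_, ?_⟩
  · exact Unitary.coe_star_mul_self hA.eigenvectorUnitary
  · exact Unitary.coe_mul_star_self hA.eigenvectorUnitary
  · conv_lhs => rw [hA.spectral_theorem]
    rfl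

theorem exists_orthonormal_spanning (S : Submodule ℂ (Fin n → ℂ)) :
    ∃ (f : ℕ) (u : Fin f → Fin n → ℂ), (∀ i, u i ∈ S) ∧
      (∀ i j, star (u i) ⬝ᵥ u j = if i = j then 1 else 0) ∧
      ∀ w ∈ S, ∃ c : Fin f → ℂ, w = ∑ j, c j • u j := by
  let e := WithLp.linearEquiv 2 ℂ (Fin n → ℂ)
  let S' : Submodule ℂ (EuclideanSpace ℂ (Fin n)) := S.comap e.toLinearMap
  let b := stdOrthonormalBasis ℂ S'
  refine ⟨_, fun i => e (b i : EuclideanSpace ℂ (Fin n)), fun i => (b i).2, fun i j => ?_,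
    fun w hw => ?_⟩
  · have h := orthonormal_iff_ite.1 b.orthonormal i j
    rw [← h, Submodule.coe_inner, EuclideanSpace.inner_eq_star_dotProduct, dotProduct_comm]
    rfl
  · have hw' : e.symm w ∈ S' := by
      change e (e.symm w) ∈ S
      rwa [e.apply_symm_apply]
    refine ⟨fun j => b.repr ⟨_, hw'⟩ j, ?_⟩
    have h := congrArg (fun y : S' => e (y : EuclideanSpace ℂ (Fin n))) (b.sum_repr ⟨_, hw'⟩)
    simp only [LinearEquiv.apply_symm_apply] at h
    refine h.symm.trans ?_
    simp

theorem exists_isometry_of_projection {p : Op n} (hp : pᴴ = p) (hpp : p * p = p) :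
    ∃ (g : ℕ) (V : Matrix (Fin n) (Fin g) ℂ), Vᴴ * V = 1 ∧ V * Vᴴ = p := by
  obtain ⟨g, u, hu, ho, hs⟩ := exists_orthonormal_spanning (LinearMap.range p.mulVecLin)
  let V : Matrix (Fin n) (Fin g) ℂ := Matrix.of fun x s => u s x
  have h1 : Vᴴ * V = 1 := by
    ext i j
    rw [Matrix.one_apply, ← ho i j]
    simp [V, Matrix.mul_apply, dotProduct]
  have h2 : p * V = V := by
    ext x s
    obtain ⟨y, hy⟩ := hu s
    have : p *ᵥ u s = u s := by
      rw [← hy, mulVecLin_apply, mulVec_mulVec, hpp]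
    calc (p * V) x s = (p *ᵥ u s) x := by simp [V, Matrix.mul_apply, mulVec, dotProduct]
      _ = _ := by rw [this]; rfl
  have h3 : ∀ y, ∃ c : Fin g → ℂ, (fun x => p x y) = ∑ j, c j • u j := by
    intro y
    refine hs _ ⟨Pi.single y 1, ?_⟩
    ext x
    simp
  choose c hc using h3
  have h4 : p = V * Matrix.of fun s y => c y s := by
    ext x y
    have := congrFun (hc y) x
    simp only [Finset.sum_apply, Pi.smul_apply, smul_eq_mul] at this
    rw [this, Matrix.mul_apply]
    exact Finset.sum_congr rfl fun s _ => mul_comm _ _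
  refine ⟨g, V, h1, ?_⟩
  have h5 : V * Vᴴ * p = p := by
    conv_lhs => rw [h4]
    rw [← Matrix.mul_assoc, Matrix.mul_assoc V, h1, Matrix.mul_one, ← h4]
  have h6 := congrArg conjTranspose h5
  rw [conjTranspose_mul, conjTranspose_mul, conjTranspose_conjTranspose, hp, ← Matrix.mul_assoc,
    h2] at h6
  exact h6

/-- Take a nonzero `a` in the algebra with maximal kernel: any element whose kernel is strictly
larger vanishes. Applied to `h² - d h`, where `h = a† a` has the nonzero eigenvalue `d`, this makes
`h / d` a projection `p`; applied to `p x p - μ p`, with `μ` an eigenvalue of `p x p` on the range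
of `p`, it makes `p` minimal. No unit is needed. -/
theorem exists_minimal_projection (𝒜 : Submodule ℂ (Op n))
    (hmul : ∀ x ∈ 𝒜, ∀ y ∈ 𝒜, x * y ∈ 𝒜) (hstar : ∀ x ∈ 𝒜, xᴴ ∈ 𝒜) (hne : 𝒜 ≠ ⊥) :
    ∃ p ∈ 𝒜, p ≠ 0 ∧ pᴴ = p ∧ p * p = p ∧ ∀ x ∈ 𝒜, ∃ c : ℂ, p * x * p = c • p := by
  have hmin : ∃ a ∈ 𝒜, a ≠ 0 ∧ ∀ b ∈ 𝒜, LinearMap.ker a.mulVecLin < LinearMap.ker b.mulVecLin →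
      b = 0 := by
    obtain ⟨a0, ha0, hne0⟩ := Submodule.exists_mem_ne_zero_of_ne_bot hne
    obtain ⟨K, ⟨a, ha, hane, rfl⟩, hK⟩ := (wellFounded_gt (α := Submodule ℂ (Fin n → ℂ))).has_min
      {K | ∃ a ∈ 𝒜, a ≠ 0 ∧ K = LinearMap.ker a.mulVecLin} ⟨_, a0, ha0, hne0, rfl⟩
    refine ⟨a, ha, hane, fun b hb hlt => ?_⟩
    by_contra hb0
    exact hK _ ⟨b, hb, hb0, rfl⟩ hlt
  obtain ⟨a, ha, ha0, hmax⟩ := hmin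
  set h := aᴴ * a with hdef
  have hh : h ∈ 𝒜 := hmul _ (hstar _ ha) _ ha
  have hherm : h.IsHermitian := isHermitian_conjTranspose_mul_self a
  have hh0 : h ≠ 0 := by
    rw [hdef, Ne, conjTranspose_mul_self_eq_zero]; exact ha0
  have hker : LinearMap.ker h.mulVecLin = LinearMap.ker a.mulVecLin :=
    ker_mulVecLin_conjTranspose_mul_self a
  have hmax' : ∀ b ∈ 𝒜, (∀ v, h *ᵥ v = 0 → b *ᵥ v = 0) → (∃ w, b *ᵥ w = 0 ∧ h *ᵥ w ≠ 0) →
      b = 0 := by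
    intro b hb hle ⟨w, hw, hw'⟩
    refine hmax b hb ?_
    rw [← hker]
    refine lt_of_le_of_ne (fun v hv => ?_) fun heq => ?_
    · rw [LinearMap.mem_ker, mulVecLin_apply] at hv ⊢
      exact hle v hv
    · have : w ∈ LinearMap.ker b.mulVecLin := by rwa [LinearMap.mem_ker, mulVecLin_apply]
      rw [← heq, LinearMap.mem_ker, mulVecLin_apply] at this
      exact hw' this
  obtain ⟨U, d, hU, hU', hUd⟩ := hherm.exists_unitary_diagonal
  have hd : ∃ i, d i ≠ 0 := by
    by_contra! hd
    apply hh0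
    rw [hUd]
    simp [hd]
  obtain ⟨i, hi⟩ := hd
  have hi' : (d i : ℂ) ≠ 0 := by exact_mod_cast hi
  have heig : h *ᵥ (U *ᵥ Pi.single i 1) = (d i : ℂ) • (U *ᵥ Pi.single i 1) := by
    conv_lhs => rw [hUd]
    rw [mulVec_mulVec, Matrix.mul_assoc, hU, Matrix.mul_one, ← mulVec_mulVec, diagonal_mulVec_single,
      ← mulVec_smul, ← Pi.single_smul]
    simp
  have hu0 : U *ᵥ Pi.single i 1 ≠ 0 := by
    intro h0
    have := congrArg (fun v => Uᴴ *ᵥ v) h0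
    simp only [mulVec_mulVec, hU, one_mulVec, mulVec_zero] at this
    have := congrFun this i
    simp at this
  have hsq : h * h = (d i : ℂ) • h := by
    rw [← sub_eq_zero]
    refine hmax' _ (𝒜.sub_mem (hmul _ hh _ hh) (𝒜.smul_mem _ hh)) (fun v hv => ?_)
      ⟨U *ᵥ Pi.single i 1, ?_, ?_⟩
    · rw [sub_mulVec, smul_mulVec, ← mulVec_mulVec, hv, mulVec_zero, smul_zero, sub_zero]
    · rw [sub_mulVec, smul_mulVec, ← mulVec_mulVec, heig, mulVec_smul, heig, sub_self]
    · rw [heig]; exact smul_ne_zero hi' hu0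
  set p := (d i : ℂ)⁻¹ • h with hp
  have hpmem : p ∈ 𝒜 := 𝒜.smul_mem _ hh
  have hpp : p * p = p := by
    rw [hp, smul_mul_smul_comm, hsq, smul_smul, mul_assoc, inv_mul_cancel₀ hi', mul_one]
  have hp0 : p ≠ 0 := smul_ne_zero (inv_ne_zero hi') hh0
  have hph : ∀ v, p *ᵥ v = 0 ↔ h *ᵥ v = 0 := by
    intro v
    rw [hp, smul_mulVec, smul_eq_zero]
    simp [hi]
  refine ⟨p, hpmem, hp0, ?_, hpp, fun x hx => ?_⟩
  · rw [hp, conjTranspose_smul, hherm.eq]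
    simp
  · set y := p * x * p with hy
    let R := LinearMap.range p.mulVecLin
    have hR : ∀ v ∈ R, y.mulVecLin v ∈ R := by
      intro v _
      refine ⟨(x * p) *ᵥ v, ?_⟩
      rw [mulVecLin_apply, mulVecLin_apply, mulVec_mulVec, hy, Matrix.mul_assoc]
    have hnt : Nontrivial R := by
      rw [Submodule.nontrivial_iff_ne_bot]
      intro hbot
      rw [LinearMap.range_eq_bot] at hbot
      apply hp0
      ext a b
      have := congrFun (LinearMap.congr_fun hbot (Pi.single b 1)) a
      simpa using this
    obtain ⟨μ, hμ⟩ := Module.End.exists_eigenvalue (y.mulVecLin.restrict hR)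
    obtain ⟨w, hw⟩ := hμ.exists_hasEigenvector
    have hw1 : y *ᵥ (w : Fin n → ℂ) = μ • (w : Fin n → ℂ) := by
      have := congrArg Subtype.val hw.apply_eq_smul
      simpa using this
    have hw0 : (w : Fin n → ℂ) ≠ 0 := fun h => hw.2 (Subtype.ext h)
    have hpw : p *ᵥ (w : Fin n → ℂ) = w := by
      obtain ⟨v, hv⟩ := w.2
      rw [← hv, mulVecLin_apply, mulVec_mulVec, hpp]
    refine ⟨μ, ?_⟩
    rw [← sub_eq_zero]
    refine hmax' _ (𝒜.sub_mem (hmul _ (hmul _ hpmem _ hx) _ hpmem) (𝒜.smul_mem _ hpmem))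
      (fun v hv => ?_) ⟨w, ?_, ?_⟩
    · rw [← hph] at hv
      rw [sub_mulVec, smul_mulVec, hy, ← mulVec_mulVec, hv, mulVec_zero, smul_zero, sub_zero]
    · rw [sub_mulVec, smul_mulVec, hw1, hpw, sub_self]
    · rw [Ne, ← hph, hpw]; exact hw0

/-- A block `ℂᶠ ⊗ ℂᵍ` of `ℂⁿ`, given by a co-isometry. -/
structure Block (n : ℕ) where
  /-- dimension of the first factor -/
  f : ℕ
  /-- dimension of the second factor -/
  g : ℕ
  f_pos : 0 < f
  g_pos : 0 < g
  /-- the block map -/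
  W : Matrix (Fin f × Fin g) (Fin n) ℂ
  W_self : W * Wᴴ = 1

namespace Block

/-- The embedding `X ↦ W† (X ⊗ 1) W`. -/
def emb (b : Block n) (X : Matrix (Fin b.f) (Fin b.f) ℂ) : Op n :=
  b.Wᴴ * (X ⊗ₖ (1 : Matrix (Fin b.g) (Fin b.g) ℂ)) * b.W

/-- The orthogonal projection onto the block. -/
def proj (b : Block n) : Op n := b.Wᴴ * b.W

theorem emb_one (b : Block n) : b.emb 1 = b.proj := by
  rw [emb, proj, one_kronecker_one, Matrix.mul_one]

theorem W_mul_emb (b : Block n) (X : Matrix (Fin b.f) (Fin b.f) ℂ) :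
    b.W * b.emb X = (X ⊗ₖ (1 : Matrix (Fin b.g) (Fin b.g) ℂ)) * b.W := by
  rw [emb, ← Matrix.mul_assoc, ← Matrix.mul_assoc, b.W_self, Matrix.one_mul]

theorem proj_mul_emb (b : Block n) (X : Matrix (Fin b.f) (Fin b.f) ℂ) :
    b.proj * b.emb X = b.emb X := by
  rw [proj, Matrix.mul_assoc, W_mul_emb, emb, Matrix.mul_assoc]

theorem proj_mul_proj (b : Block n) : b.proj * b.proj = b.proj := by
  rw [proj, Matrix.mul_assoc, ← Matrix.mul_assoc b.W, b.W_self, Matrix.one_mul]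

theorem conjTranspose_proj (b : Block n) : b.projᴴ = b.proj := by
  rw [proj, conjTranspose_mul, conjTranspose_conjTranspose]

theorem W_mul_proj (b : Block n) : b.W * b.proj = b.W := by
  rw [proj, ← Matrix.mul_assoc, b.W_self, Matrix.one_mul]

theorem proj_ne_zero (b : Block n) : b.proj ≠ 0 := by
  intro h
  have h1 : b.W * b.proj * b.Wᴴ = 1 := by rw [W_mul_proj, b.W_self]
  rw [h, Matrix.mul_zero, Matrix.zero_mul] at h1
  have := congrFun (congrFun h1 (⟨0, b.f_pos⟩, ⟨0, b.g_pos⟩)) (⟨0, b.f_pos⟩, ⟨0, b.g_pos⟩)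
  simp at this

end Block

/-- Pairing with `v` gives `c = ‖y v‖² = 0`. Thus elements of the left ideal of a minimal projection
are determined by their value at one unit vector. -/
theorem eq_zero_of_projection_compression {p y : Op n} {v : Fin n → ℂ} (hv : star v ⬝ᵥ v = 1)
    (hpv : p *ᵥ v = v) {c : ℂ} (hc : yᴴ * y = c • p) (hyv : y *ᵥ v = 0) : y = 0 := by
  have h1 : star v ⬝ᵥ ((yᴴ * y) *ᵥ v) = 0 := by
    rw [← mulVec_mulVec, hyv, mulVec_zero, dotProduct_zero]
  rw [hc, smul_mulVec, hpv, dotProduct_smul, hv, smul_eq_mul, mul_one] at h1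
  rw [h1, zero_smul] at hc
  exact conjTranspose_mul_self_eq_zero.1 hc

/-- For a minimal projection `p` and a unit vector `v` in its range, `x ↦ x v` is isometric on the
left ideal `𝒜 p`, in the sense that `x† y = ⟨x v, y v⟩ p`. An orthonormal basis of `𝒜 v` lifts to `a
i` with `(a i)† (a j) = δ p`, so the products `a i (a j)†` are matrix units. Here `f = dim 𝒜 v` and
`g = rank p`. -/
theorem exists_block (𝒜 : Submodule ℂ (Op n))
    (hmul : ∀ x ∈ 𝒜, ∀ y ∈ 𝒜, x * y ∈ 𝒜) (hstar : ∀ x ∈ 𝒜, xᴴ ∈ 𝒜) (hne : 𝒜 ≠ ⊥) :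
    ∃ b : Block n, (∀ X, b.emb X ∈ 𝒜) ∧ ∀ x ∈ 𝒜, ∃ X, x * b.proj = b.emb X := by
  obtain ⟨p, hp, hp0, hph, hpp, hmin⟩ := exists_minimal_projection 𝒜 hmul hstar hne
  obtain ⟨g, V, hV, hVp⟩ := exists_isometry_of_projection hph hpp
  have hpV : p * V = V := by rw [← hVp, Matrix.mul_assoc, hV, Matrix.mul_one]
  have hg : 0 < g := by
    rcases Nat.eq_zero_or_pos g with rfl | h
    · exfalso; apply hp0; rw [← hVp]; ext i j; simp [Matrix.mul_apply]
    · exact h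
  set v : Fin n → ℂ := V *ᵥ Pi.single ⟨0, hg⟩ 1 with hvdef
  have hv : star v ⬝ᵥ v = 1 := by
    rw [hvdef, star_mulVec, dotProduct_mulVec, vecMul_vecMul, hV, vecMul_one]
    simp
  have hpv : p *ᵥ v = v := by rw [hvdef, mulVec_mulVec, hpV]
  obtain ⟨f, u, hu, ho, hs⟩ := exists_orthonormal_spanning
    (𝒜.map ((LinearMap.applyₗ v).comp (Matrix.toLin' : Op n ≃ₗ[ℂ] _).toLinearMap))
  have hu' : ∀ i, ∃ a ∈ 𝒜, a * p = a ∧ a *ᵥ v = u i := by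
    intro i
    obtain ⟨a, ha, hau⟩ := hu i
    refine ⟨a * p, hmul _ ha _ hp, by rw [Matrix.mul_assoc, hpp], ?_⟩
    rw [← mulVec_mulVec, hpv, ← hau]
    simp
  choose a ha hap hau using hu'
  have hcomp : ∀ x ∈ 𝒜, x * p = x → ∀ y ∈ 𝒜, y * p = y → ∃ c : ℂ, xᴴ * y = c • p := by
    intro x hx hxp y hy hyp
    obtain ⟨c, hc⟩ := hmin (xᴴ * y) (hmul _ (hstar _ hx) _ hy)
    refine ⟨c, ?_⟩
    rw [← hc, Matrix.mul_assoc, Matrix.mul_assoc, hyp, ← Matrix.mul_assoc]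
    conv_lhs => rw [← hxp, conjTranspose_mul, hph]
  have haa : ∀ i j, (a i)ᴴ * a j = (if i = j then (1 : ℂ) else 0) • p := by
    intro i j
    obtain ⟨c, hc⟩ := hcomp _ (ha i) (hap i) _ (ha j) (hap j)
    rw [hc, ← ho i j, ← hau i, ← hau j, star_mulVec, dotProduct_mulVec, vecMul_vecMul, hc,
      ← dotProduct_mulVec, smul_mulVec, hpv, dotProduct_smul, hv, smul_eq_mul, mul_one]
  have hexp : ∀ x ∈ 𝒜, ∀ i, ∃ c : Fin f → ℂ, x * a i = ∑ j, c j • a j := by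
    intro x hx i
    obtain ⟨c, hc⟩ := hs ((x * a i) *ᵥ v) ⟨x * a i, hmul _ hx _ (ha i), by simp⟩
    refine ⟨c, ?_⟩
    rw [← sub_eq_zero]
    have hmem : x * a i - ∑ j, c j • a j ∈ 𝒜 :=
      𝒜.sub_mem (hmul _ hx _ (ha i)) (𝒜.sum_mem fun j _ => 𝒜.smul_mem _ (ha j))
    have hyp : (x * a i - ∑ j, c j • a j) * p = x * a i - ∑ j, c j • a j := by
      rw [sub_mul, Matrix.mul_assoc, hap, Finset.sum_mul]
      simp only [smul_mul_assoc, hap]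
    obtain ⟨c', hc'⟩ := hcomp _ hmem hyp _ hmem hyp
    refine eq_zero_of_projection_compression hv hpv hc' ?_
    rw [sub_mulVec, hc, sum_mulVec]
    simp only [smul_mulVec, hau, sub_self]
  have hf : 0 < f := by
    rcases Nat.eq_zero_or_pos f with rfl | h
    · exfalso
      obtain ⟨c, hc⟩ := hs v ⟨p, hp, by simp [hpv]⟩
      simp only [Finset.univ_eq_empty, Finset.sum_empty] at hc
      rw [hc] at hv
      simp at hv
    · exact h
  -- Row `(i, s)` is the adjoint of the vector `a i V e_s`; these vectors are orthonormal.
  let W : Matrix (Fin f × Fin g) (Fin n) ℂ := Matrix.of fun r x => star ((a r.1 * V) x r.2)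
  have hWW : W * Wᴴ = 1 := by
    ext ⟨i, s⟩ ⟨j, t⟩
    have h1 : (W * Wᴴ) (i, s) (j, t) = ((a i * V)ᴴ * (a j * V)) s t := by
      simp only [W, Matrix.mul_apply, conjTranspose_apply, of_apply, star_star]
    rw [h1, conjTranspose_mul, Matrix.mul_assoc, ← Matrix.mul_assoc (a i)ᴴ, haa,
      Matrix.smul_mul, hpV, Matrix.mul_smul, hV]
    by_cases hij : i = j <;> simp [hij, Matrix.one_apply]
  let b : Block n := ⟨f, g, hf, hg, W, hWW⟩
  have hemb : ∀ X : Matrix (Fin f) (Fin f) ℂ, b.emb X = ∑ i, ∑ j, X i j • (a i * (a j)ᴴ) := by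
    intro X
    have h1 : ∀ i j, a i * (a j)ᴴ = (a i * V) * (a j * V)ᴴ := by
      intro i j
      rw [conjTranspose_mul, Matrix.mul_assoc, ← Matrix.mul_assoc V, hVp, ← Matrix.mul_assoc, hap]
    ext x y
    simp only [h1, Block.emb, b, Matrix.sum_apply, Matrix.smul_apply, smul_eq_mul]
    rw [Matrix.mul_assoc]
    simp only [Matrix.mul_apply (M := Wᴴ), Matrix.mul_apply (M := X ⊗ₖ (1 : Matrix _ _ ℂ)),
      Fintype.sum_prod_type, kroneckerMap_apply, Matrix.one_apply, mul_ite, mul_one, mul_zero,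
      ite_mul, zero_mul, Finset.sum_ite_eq, Finset.mem_univ, if_true]
    refine Finset.sum_congr rfl fun i _ => ?_
    simp only [Finset.mul_sum]
    rw [Finset.sum_comm]
    refine Finset.sum_congr rfl fun j _ => ?_
    rw [Matrix.mul_apply (M := a i * V), Finset.mul_sum]
    refine Finset.sum_congr rfl fun s _ => ?_
    simp only [W, conjTranspose_apply, of_apply, star_star]
    ring
  refine ⟨b, fun X => ?_, fun x hx => ?_⟩
  · rw [hemb]
    exact 𝒜.sum_mem fun i _ => 𝒜.sum_mem fun j _ =>
      𝒜.smul_mem _ (hmul _ (ha i) _ (hstar _ (ha j)))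
  · choose c hc using hexp x hx
    -- Left multiplication by `x` on the ideal has these coefficients, transposed because `c i`
    -- lists the image of `a i`, which is a column.
    refine ⟨Matrix.of fun j i => c i j, ?_⟩
    rw [← Block.emb_one, hemb, hemb, Finset.mul_sum, Finset.sum_comm]
    refine Finset.sum_congr rfl fun i _ => ?_
    rw [Finset.sum_eq_single i]
    · rw [one_apply_eq, one_smul, ← Matrix.mul_assoc, hc, Finset.sum_mul]
      simp only [smul_mul_assoc, of_apply]
    · intro j _ hj
      rw [one_apply_ne hj.symm]
      simp
    · simp

/-- Block structure of a `*`-closed algebra of matrices. -/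
theorem exists_blocks (𝒜 : Submodule ℂ (Op n))
    (hmul : ∀ x ∈ 𝒜, ∀ y ∈ 𝒜, x * y ∈ 𝒜) (hstar : ∀ x ∈ 𝒜, xᴴ ∈ 𝒜) :
    ∃ (K : ℕ) (b : Fin K → Block n), (∀ k l, k ≠ l → (b k).W * ((b l).W)ᴴ = 0) ∧
      (∀ k X, (b k).emb X ∈ 𝒜) ∧ (∀ x ∈ 𝒜, x = ∑ k, (b k).proj * x) ∧
      ∀ x ∈ 𝒜, ∀ k, ∃ X, (b k).proj * x = (b k).emb X := by
  induction hd : Module.finrank ℂ 𝒜 using Nat.strong_induction_on generalizing 𝒜 with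
  | _ d ih =>
  by_cases hne : 𝒜 = ⊥
  · refine ⟨0, Fin.elim0, fun k => k.elim0, fun k => k.elim0, fun x hx => ?_, fun x hx k => k.elim0⟩
    rw [hne, Submodule.mem_bot] at hx
    simp [hx]
  obtain ⟨b, hb, hbx⟩ := exists_block 𝒜 hmul hstar hne
  have hz : b.proj ∈ 𝒜 := by rw [← b.emb_one]; exact hb 1
  have hzxz : ∀ x ∈ 𝒜, b.proj * (x * b.proj) = x * b.proj := by
    intro x hx
    obtain ⟨X, hX⟩ := hbx x hx
    rw [hX, b.proj_mul_emb]
  -- The block projection is central: `z x z = x z` for all `x`, and the adjoint of this for `x†` is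
  -- `z x z = z x`.
  have hcomm : ∀ x ∈ 𝒜, b.proj * x = x * b.proj := by
    intro x hx
    have h1 := congrArg conjTranspose (hzxz _ (hstar x hx))
    simp only [conjTranspose_mul, conjTranspose_conjTranspose, b.conjTranspose_proj] at h1
    rw [← h1, Matrix.mul_assoc, hzxz x hx]
  -- The ideal annihilated by the block is smaller, since it misses the block projection; the
  -- induction on dimension continues there.
  let 𝒜' : Submodule ℂ (Op n) := 𝒜 ⊓ LinearMap.ker (LinearMap.mulRight ℂ b.proj)
  have hmem' : ∀ x, x ∈ 𝒜' ↔ x ∈ 𝒜 ∧ x * b.proj = 0 := by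
    intro x
    rw [Submodule.mem_inf, LinearMap.mem_ker, LinearMap.mulRight_apply]
  have hlt : Module.finrank ℂ 𝒜' < d := by
    rw [← hd]
    refine Submodule.finrank_lt_finrank_of_lt (lt_of_le_of_ne inf_le_left fun h => ?_)
    have := hz
    rw [← h, hmem', b.proj_mul_proj] at this
    exact b.proj_ne_zero this.2
  obtain ⟨K, b', ho, he, hsum, hex⟩ := ih _ hlt 𝒜'
    (fun x hx y hy => by
      rw [hmem'] at hx hy ⊢
      exact ⟨hmul _ hx.1 _ hy.1, by rw [Matrix.mul_assoc, hy.2, Matrix.mul_zero]⟩)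
    (fun x hx => by
      rw [hmem'] at hx ⊢
      refine ⟨hstar _ hx.1, ?_⟩
      have := hx.2
      rw [← hcomm x hx.1] at this
      rw [← b.conjTranspose_proj, ← conjTranspose_mul, this, conjTranspose_zero]) rfl
  have horth : ∀ l, b.proj * (b' l).Wᴴ = 0 := by
    intro l
    have h1 := (hmem' _).1 (he l 1)
    have h2 := h1.2
    rw [← hcomm _ h1.1, Block.emb_one] at h2
    have h3 : b.proj * (b' l).proj * (b' l).Wᴴ = b.proj * (b' l).Wᴴ := by
      rw [Block.proj, Block.proj, Matrix.mul_assoc, Matrix.mul_assoc (b' l).Wᴴ, (b' l).W_self,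
        Matrix.mul_one]
    rw [← h3, h2, Matrix.zero_mul]
  have horth1 : ∀ l, b.W * (b' l).Wᴴ = 0 := by
    intro l
    rw [← b.W_mul_proj, Matrix.mul_assoc, horth, Matrix.mul_zero]
  have horth2 : ∀ l, (b' l).W * b.Wᴴ = 0 := by
    intro l
    rw [← conjTranspose_conjTranspose ((b' l).W * b.Wᴴ), conjTranspose_mul,
      conjTranspose_conjTranspose, horth1, conjTranspose_zero]
  have hrest : ∀ x ∈ 𝒜, x - b.proj * x ∈ 𝒜' := by
    intro x hx
    rw [hmem']
    refine ⟨𝒜.sub_mem hx (hmul _ hz _ hx), ?_⟩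
    rw [sub_mul, Matrix.mul_assoc, hzxz x hx, sub_self]
  have hrest' : ∀ x l, (b' l).proj * (x - b.proj * x) = (b' l).proj * x := by
    intro x l
    have h1 : (b' l).proj * (b.proj * x) = (b' l).Wᴴ * ((b' l).W * b.Wᴴ) * (b.W * x) := by
      simp only [Block.proj, Matrix.mul_assoc]
    rw [mul_sub, h1, horth2, Matrix.mul_zero, Matrix.zero_mul, sub_zero]
  refine ⟨K + 1, Fin.cons b b', ?_, ?_, ?_, ?_⟩
  · intro k l
    refine Fin.cases ?_ (fun k => ?_) k <;> refine Fin.cases ?_ (fun l => ?_) l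
    · intro h; exact absurd rfl h
    · intro _; exact horth1 l
    · intro _; exact horth2 k
    · intro h; exact ho k l fun h' => h (by rw [h'])
  · intro k
    refine Fin.cases ?_ (fun k => ?_) k
    · exact hb
    · exact fun X => ((hmem' _).1 (he k X)).1
  · intro x hx
    rw [Fin.sum_univ_succ]
    simp only [Fin.cons_zero, Fin.cons_succ]
    have h1 := hsum _ (hrest x hx)
    simp only [hrest'] at h1
    rw [← h1]; abel
  · intro x hx k
    refine Fin.cases ?_ (fun k => ?_) k
    · obtain ⟨X, hX⟩ := hbx x hx
      exact ⟨X, (hcomm x hx).trans hX⟩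
    · obtain ⟨X, hX⟩ := hex _ (hrest x hx) k
      exact ⟨X, (hrest' x k).symm.trans hX⟩

end Wedderburn

/-! ### Partial trace identities. -/

section PartialTrace

open Matrix

theorem partialTrace_kronecker {f g : ℕ} (A : Matrix (Fin f) (Fin f) ℂ)
    (B : Matrix (Fin g) (Fin g) ℂ) : partialTrace f g (A ⊗ₖ B) = B.trace • A := by
  ext i j
  simp [partialTrace, Matrix.trace, mul_comm, Finset.mul_sum]

theorem partialTrace_mul_kronecker_one {f g : ℕ} (Y : Matrix (Fin f × Fin g) (Fin f × Fin g) ℂ)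
    (X : Matrix (Fin f) (Fin f) ℂ) :
    partialTrace f g (Y * (X ⊗ₖ (1 : Matrix (Fin g) (Fin g) ℂ))) = partialTrace f g Y * X := by
  ext i j
  simp only [partialTrace, LinearMap.coe_mk, AddHom.coe_mk, of_apply, Matrix.mul_apply,
    Fintype.sum_prod_type, kroneckerMap_apply, Matrix.one_apply, mul_ite, mul_one, mul_zero,
    Finset.sum_ite_eq', Finset.mem_univ, if_true, Finset.sum_mul]
  rw [Finset.sum_comm]

theorem partialTrace_kronecker_one_mul {f g : ℕ} (Y : Matrix (Fin f × Fin g) (Fin f × Fin g) ℂ)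
    (X : Matrix (Fin f) (Fin f) ℂ) :
    partialTrace f g ((X ⊗ₖ (1 : Matrix (Fin g) (Fin g) ℂ)) * Y) = X * partialTrace f g Y := by
  ext i j
  simp only [partialTrace, LinearMap.coe_mk, AddHom.coe_mk, of_apply, Matrix.mul_apply,
    Fintype.sum_prod_type, kroneckerMap_apply, Matrix.one_apply, mul_ite, mul_one, mul_zero,
    ite_mul, zero_mul, Finset.sum_ite_eq, Finset.mem_univ, if_true, Finset.mul_sum]
  rw [Finset.sum_comm]

theorem trace_partialTrace {f g : ℕ} (Y : Matrix (Fin f × Fin g) (Fin f × Fin g) ℂ) :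
    (partialTrace f g Y).trace = Y.trace := by
  simp [partialTrace, Matrix.trace, Fintype.sum_prod_type]

end PartialTrace

/-! ### Algebra of the embedding, the injection and the compression. -/

namespace BlockData

open Matrix

variable {n : ℕ} (D : BlockData n)

/-- The operator with blocks `B k` on `F k ⊗ G k`. -/
def blockSum (B : ∀ k, Matrix (Fin (D.f k) × Fin (D.g k)) (Fin (D.f k) × Fin (D.g k)) ℂ) : Op n :=
  ∑ k, (D.W k)ᴴ * B k * D.W k

theorem W_mul_blockSum
    (B : ∀ k, Matrix (Fin (D.f k) × Fin (D.g k)) (Fin (D.f k) × Fin (D.g k)) ℂ) (k : Fin D.K) :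
    D.W k * D.blockSum B = B k * D.W k := by
  rw [blockSum, Matrix.mul_sum, Finset.sum_eq_single k]
  · rw [← Matrix.mul_assoc, ← Matrix.mul_assoc, D.W_self, Matrix.one_mul]
  · intro l _ hl
    rw [← Matrix.mul_assoc, ← Matrix.mul_assoc, D.W_orth k l hl.symm, Matrix.zero_mul,
      Matrix.zero_mul]
  · simp

theorem blockSum_mul_blockSum
    (B B' : ∀ k, Matrix (Fin (D.f k) × Fin (D.g k)) (Fin (D.f k) × Fin (D.g k)) ℂ) :
    D.blockSum B * D.blockSum B' = D.blockSum fun k => B k * B' k := by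
  conv_lhs => rw [blockSum, Finset.sum_mul]
  refine Finset.sum_congr rfl fun k _ => ?_
  rw [Matrix.mul_assoc, W_mul_blockSum, Matrix.mul_assoc, Matrix.mul_assoc, Matrix.mul_assoc]

theorem conjTranspose_blockSum
    (B : ∀ k, Matrix (Fin (D.f k) × Fin (D.g k)) (Fin (D.f k) × Fin (D.g k)) ℂ) :
    (D.blockSum B)ᴴ = D.blockSum fun k => (B k)ᴴ := by
  simp [blockSum, conjTranspose_sum, Matrix.mul_assoc]

theorem posSemidef_blockSum
    {B : ∀ k, Matrix (Fin (D.f k) × Fin (D.g k)) (Fin (D.f k) × Fin (D.g k)) ℂ}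
    (hB : ∀ k, (B k).PosSemidef) : (D.blockSum B).PosSemidef :=
  posSemidef_sum _ fun k _ => (hB k).conjTranspose_mul_mul_same _

/-- The embedding `⨁ₖ Xₖ ↦ U [⨁ₖ (Xₖ ⊗ 1) ⊕ 0] U†` of the reduced algebra. -/
def embed (X : D.Reduced) : Op n := D.blockSum fun k => X k ⊗ₖ 1

theorem injection_eq (X : D.Reduced) : D.injection X = D.blockSum fun k => X k ⊗ₖ D.τ k := rfl

theorem supportProj_eq : D.supportProj = D.embed 1 := by
  simp [supportProj, embed, blockSum]

theorem embed_mul_embed (X Y : D.Reduced) : D.embed X * D.embed Y = D.embed (X * Y) := by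
  simp only [embed, blockSum_mul_blockSum, ← mul_kronecker_mul, Matrix.one_mul, Pi.mul_apply]

theorem embed_mul_injection (X Y : D.Reduced) :
    D.embed X * D.injection Y = D.injection (X * Y) := by
  simp only [embed, injection_eq, blockSum_mul_blockSum, ← mul_kronecker_mul, Matrix.one_mul,
    Pi.mul_apply]

theorem injection_mul_embed (X Y : D.Reduced) :
    D.injection X * D.embed Y = D.injection (X * Y) := by
  simp only [embed, injection_eq, blockSum_mul_blockSum, ← mul_kronecker_mul, Matrix.mul_one,
    Pi.mul_apply]

theorem conjTranspose_embed (X : D.Reduced) : (D.embed X)ᴴ = D.embed (star X) := by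
  simp only [embed, conjTranspose_blockSum, conjTranspose_kronecker, conjTranspose_one]
  rfl

theorem conjTranspose_injection (X : D.Reduced) : (D.injection X)ᴴ = D.injection (star X) := by
  simp only [injection_eq, conjTranspose_blockSum, conjTranspose_kronecker,
    (D.τ_posDef _).isHermitian.eq]
  rfl

theorem compression_apply (X : Op n) (k : Fin D.K) :
    D.compression X k = partialTrace (D.f k) (D.g k) (D.W k * X * (D.W k)ᴴ) := rfl

theorem compression_injection (X : D.Reduced) : D.compression (D.injection X) = X := by
  funext k
  rw [compression_apply, injection_eq, W_mul_blockSum, Matrix.mul_assoc, D.W_self, Matrix.mul_one,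
    partialTrace_kronecker, D.τ_trace, one_smul]

theorem injection_injective : Function.Injective D.injection :=
  Function.LeftInverse.injective D.compression_injection

theorem compression_embed_mul (X : D.Reduced) (Z : Op n) :
    D.compression (D.embed X * Z) = X * D.compression Z := by
  funext k
  rw [compression_apply, ← Matrix.mul_assoc, embed, W_mul_blockSum, Matrix.mul_assoc,
    Matrix.mul_assoc, partialTrace_kronecker_one_mul, Pi.mul_apply, compression_apply,
    Matrix.mul_assoc]

/-- The compression is the adjoint of the embedding for the trace pairing, so operators on the
reduced algebra can be tested against embedded ones. -/
theorem trace_embed_mul (X : D.Reduced) (Z : Op n) :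
    (D.embed X * Z).trace = D.reducedTrace (X * D.compression Z) := by
  rw [reducedTrace, embed, blockSum, Finset.sum_mul, trace_sum]
  refine Finset.sum_congr rfl fun k _ => ?_
  rw [Pi.mul_apply, compression_apply, ← partialTrace_kronecker_one_mul, trace_partialTrace,
    Matrix.mul_assoc, Matrix.mul_assoc, trace_mul_comm, Matrix.mul_assoc, Matrix.mul_assoc]

theorem embed_add (X Y : D.Reduced) : D.embed (X + Y) = D.embed X + D.embed Y := by
  simp [embed, blockSum, add_kronecker, Matrix.mul_add, Matrix.add_mul, Finset.sum_add_distrib]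

theorem embed_smul (c : ℂ) (X : D.Reduced) : D.embed (c • X) = c • D.embed X := by
  simp [embed, blockSum, smul_kronecker, Finset.smul_sum]

theorem trace_injection (X : D.Reduced) : (D.injection X).trace = D.reducedTrace X := by
  have h := D.trace_embed_mul 1 (D.injection X)
  rwa [embed_mul_injection, one_mul, one_mul, compression_injection] at h

/-- Scalars, one for each block. -/
def scalars (s : Fin D.K → ℂ) : D.Reduced := fun k => s k • 1

theorem scalars_mul (s : Fin D.K → ℂ) (X : D.Reduced) : D.scalars s * X = fun k => s k • X k := by
  funext k
  simp [scalars]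

theorem mul_scalars (s : Fin D.K → ℂ) (X : D.Reduced) : X * D.scalars s = fun k => s k • X k := by
  funext k
  simp [scalars]

theorem posSemidef_injection_scalars {s : Fin D.K → ℂ} (hs : ∀ k, 0 ≤ s k) :
    (D.injection (D.scalars s)).PosSemidef :=
  D.posSemidef_blockSum fun k => (PosSemidef.one.smul (hs k)).kronecker (D.τ_posDef k).posSemidef

/-- The `τ k` are invertible, so the injected operator has an inverse on the support; multiply by it
from the right. -/
theorem mul_supportProj_eq_zero {s : Fin D.K → ℂ} (hs : ∀ k, s k ≠ 0) {p : ℕ}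
    {A : Matrix (Fin p) (Fin n) ℂ}
    (hA : A * D.injection (D.scalars s) = 0) : A * D.supportProj = 0 := by
  have h : D.injection (D.scalars s) * D.blockSum (fun k => ((s k)⁻¹ • 1) ⊗ₖ (D.τ k)⁻¹) =
      D.supportProj := by
    rw [supportProj_eq, injection_eq, blockSum_mul_blockSum, embed]
    congr 1
    funext k
    rw [← mul_kronecker_mul, Matrix.mul_nonsing_inv _
      ((isUnit_iff_isUnit_det _).1 (D.τ_posDef k).isUnit), scalars, smul_mul_smul_comm,
      mul_inv_cancel₀ (hs k), one_smul, Matrix.one_mul]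
    rfl
  rw [← h, ← Matrix.mul_assoc, hA, Matrix.zero_mul]

end BlockData

/-! ### Fixed points of Kraus maps and commutation. -/

section KrausProjection

open Matrix

variable {n : ℕ}

theorem Matrix.IsHermitian.exists_supportProj {σ : Op n} (hσ : σ.IsHermitian) :
    ∃ p z : Op n, pᴴ = p ∧ p * p = p ∧ p * σ = σ ∧ p = σ * z := by
  obtain ⟨U, d, hU, -, hd⟩ := hσ.exists_unitary_diagonal
  have hmul : ∀ a b : Fin n → ℂ, (U * diagonal a * Uᴴ) * (U * diagonal b * Uᴴ) =
      U * diagonal (fun i => a i * b i) * Uᴴ := by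
    intro a b
    rw [← diagonal_mul_diagonal]
    calc _ = U * diagonal a * (Uᴴ * U) * diagonal b * Uᴴ := by simp only [Matrix.mul_assoc]
      _ = _ := by rw [hU, Matrix.mul_one]; simp only [Matrix.mul_assoc]
  have hd' : ∀ i, (d i : ℂ) * (d i : ℂ)⁻¹ * (d i : ℂ) = d i := by
    intro i
    by_cases h : (d i : ℂ) = 0 <;> simp [h]
  -- With `0⁻¹ = 0` the product `d d⁻¹` is the indicator of the nonzero eigenvalues, and `z` is the
  -- pseudo-inverse.
  refine ⟨U * diagonal (fun i => (d i : ℂ) * (d i : ℂ)⁻¹) * Uᴴ,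
    U * diagonal (fun i => (d i : ℂ)⁻¹) * Uᴴ, ?_, ?_, ?_, ?_⟩
  · rw [conjTranspose_mul, conjTranspose_mul, conjTranspose_conjTranspose, diagonal_conjTranspose,
      Matrix.mul_assoc]
    congr 3
    funext i
    simp
  · rw [hmul]
    congr 3
    funext i
    rw [← mul_assoc, hd']
  · conv_lhs => rw [hd]
    rw [hmul, hd]
    simp only [hd']
  · conv_rhs => rw [hd]
    rw [hmul]

/-- Each summand is positive with trace zero, hence zero; writing `σ = B† B` makes it `(T B†)(T
B†)†`, so `T B† = 0`. -/
theorem mul_eq_zero_of_sum_trace_eq_zero {ι : Type*} [Fintype ι] {m : Type*} [Fintype m]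
    {σ : Op n} (hσ : σ.PosSemidef) {T : ι → Matrix m (Fin n) ℂ}
    (h : ∑ a, (T a * σ * (T a)ᴴ).trace = 0) (a : ι) : T a * σ = 0 := by
  have hp : ∀ a, (T a * σ * (T a)ᴴ).PosSemidef := fun a => hσ.mul_mul_conjTranspose_same _
  have h0 := (Finset.sum_eq_zero_iff_of_nonneg fun a _ => (hp a).trace_nonneg).1 h a
    (Finset.mem_univ a)
  rw [(hp a).trace_eq_zero_iff] at h0
  obtain ⟨B, rfl⟩ := hσ.exists_conjTranspose_mul_self
  have h1 : (T a * Bᴴ) * (T a * Bᴴ)ᴴ = 0 := by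
    rw [conjTranspose_mul, conjTranspose_conjTranspose, ← h0]
    simp only [Matrix.mul_assoc]
  rw [self_mul_conjTranspose_eq_zero] at h1
  rw [← Matrix.mul_assoc, h1, Matrix.zero_mul]

variable {P : SuperOp n} {ι : Type} [Fintype ι] {M : ι → Op n}

/-- Expand `∑ T σ T†` with `T = [A, M a]`. All four resulting traces equal `tr (A σ A†)`, two by
invariance of `σ` and trace preservation and two by hypothesis, and the signs cancel. -/
theorem kraus_mul_fixed_eq (hM : ∀ X, P X = ∑ a, M a * X * (M a)ᴴ)
    (htr : ∀ X, (P X).trace = X.trace) {σ : Op n} (hσ : σ.PosSemidef) (hfix : P σ = σ) {A : Op n}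
    (h1 : (A * P (σ * Aᴴ)).trace = (A * σ * Aᴴ).trace)
    (h2 : (P (A * σ) * Aᴴ).trace = (A * σ * Aᴴ).trace) (a : ι) :
    (A * M a - M a * A) * σ = 0 := by
  refine mul_eq_zero_of_sum_trace_eq_zero hσ (T := fun a => A * M a - M a * A) ?_ a
  have h3 : ∑ a, ((A * M a - M a * A) * σ * (A * M a - M a * A)ᴴ) =
      A * P σ * Aᴴ - A * P (σ * Aᴴ) - P (A * σ) * Aᴴ + P (A * σ * Aᴴ) := by
    simp only [hM, Finset.mul_sum, Finset.sum_mul, ← Finset.sum_sub_distrib,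
      ← Finset.sum_add_distrib]
    refine Finset.sum_congr rfl fun a _ => ?_
    simp only [conjTranspose_sub, conjTranspose_mul]
    noncomm_ring
  rw [← trace_sum, h3, trace_add, trace_sub, trace_sub, h1, h2, htr, hfix]
  ring

theorem kraus_posSemidef (hM : ∀ X, P X = ∑ a, M a * X * (M a)ᴴ) {X : Op n} (hX : X.PosSemidef) :
    (P X).PosSemidef := by
  rw [hM]
  exact posSemidef_sum _ fun a _ => hX.mul_mul_conjTranspose_same _

theorem support_mul_kraus (hM : ∀ X, P X = ∑ a, M a * X * (M a)ᴴ) {p : Op n}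
    (hpσ : p * P 1 = P 1) (a : ι) : p * M a = M a := by
  have h : (1 - p) * P 1 * (1 - p)ᴴ = 0 := by
    rw [sub_mul, Matrix.one_mul, hpσ, sub_self, Matrix.zero_mul]
  have h2 := mul_eq_zero_of_sum_trace_eq_zero (σ := (1 : Op n)) PosSemidef.one
    (T := fun a => (1 - p) * M a) ?_ a
  · rw [Matrix.mul_one, sub_mul, Matrix.one_mul, sub_eq_zero] at h2
    exact h2.symm
  · rw [← trace_sum, ← trace_zero (Fin n) ℂ, ← h, hM]
    congr 1
    rw [Finset.mul_sum, Finset.sum_mul]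
    simp only [conjTranspose_mul, Matrix.mul_assoc]

/-- The commutant data attached to a trace-preserving completely positive idempotent: the range is
a bimodule over a `*`-algebra of operators on the support, and the algebra separates its points. -/
theorem exists_range_bimodule (hM : ∀ X, P X = ∑ a, M a * X * (M a)ᴴ)
    (htr : ∀ X, (P X).trace = X.trace) (hi : P * P = P) :
    ∃ (p z : Op n) (𝒜 : Submodule ℂ (Op n)), pᴴ = p ∧ p = P 1 * z ∧
      (∀ x ∈ 𝒜, ∀ y ∈ 𝒜, x * y ∈ 𝒜) ∧ (∀ x ∈ 𝒜, xᴴ ∈ 𝒜) ∧ p ∈ 𝒜 ∧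
      (∀ x ∈ 𝒜, p * x = x ∧ x * p = x) ∧
      (∀ x ∈ 𝒜, ∀ ρ ∈ LinearMap.range P, x * ρ ∈ LinearMap.range P ∧ ρ * x ∈ LinearMap.range P) ∧
      (∀ ρ ∈ LinearMap.range P, (∀ x ∈ 𝒜, (x * ρ).trace = 0) → ρ = 0) := by
  have hσ : (P 1).PosSemidef := kraus_posSemidef hM PosSemidef.one
  obtain ⟨p, z, hp, hpp, hpσ, hpz⟩ := hσ.isHermitian.exists_supportProj
  have hpM := support_mul_kraus hM hpσ
  have hMp : ∀ a, (M a)ᴴ * p = (M a)ᴴ := by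
    intro a
    have := congrArg conjTranspose (hpM a)
    rwa [conjTranspose_mul, hp] at this
  have hpP : ∀ X, p * P X = P X := by
    intro X
    rw [hM, Finset.mul_sum]
    simp only [← Matrix.mul_assoc, hpM]
  have hPp : ∀ X, P X * p = P X := by
    intro X
    rw [hM, Finset.sum_mul]
    simp only [Matrix.mul_assoc, hMp]
  have hfix : ∀ X, P (P X) = P X := fun X => by rw [← Module.End.mul_apply, hi]
  -- the dual map
  let E : Op n → Op n := fun B => ∑ a, (M a)ᴴ * B * M a
  have hE : ∀ B X, (E B * X).trace = (B * P X).trace := by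
    intro B X
    simp only [E, hM, Finset.sum_mul, Finset.mul_sum, trace_sum]
    refine Finset.sum_congr rfl fun a _ => ?_
    rw [Matrix.mul_assoc, Matrix.mul_assoc, trace_mul_comm]
    simp only [Matrix.mul_assoc]
  have hEE : ∀ B, E (E B) = E B := by
    intro B
    rw [ext_iff_trace_mul_right]
    intro X
    rw [hE, hE, hE, hfix]
  -- The Kraus operators map into the support, so the dual map sees only the corner `p B p`.
  have hEp : ∀ B, E (p * B * p) = E B := by
    intro B
    refine Finset.sum_congr rfl fun a _ => ?_
    calc _ = ((M a)ᴴ * p) * B * (p * M a) := by simp only [Matrix.mul_assoc]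
      _ = _ := by rw [hMp, hpM]
  have hEstar : ∀ B, (E B)ᴴ = E Bᴴ := by
    intro B
    simp only [E, conjTranspose_sum, conjTranspose_mul, conjTranspose_conjTranspose,
      Matrix.mul_assoc]
  -- This is the commutant of the compressed Kraus operators `M a p` inside the corner of `p`; `M a`
  -- itself need not vanish off the support, hence the factor `p` on one side only.
  let 𝒜 : Submodule ℂ (Op n) :=
    { carrier := {x | (p * x = x ∧ x * p = x) ∧
        ∀ a, x * M a * p = M a * x ∧ xᴴ * M a * p = M a * xᴴ}
      zero_mem' := by simp
      add_mem' := by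
        rintro x y ⟨⟨h1, h2⟩, h3⟩ ⟨⟨h4, h5⟩, h6⟩
        refine ⟨⟨by rw [mul_add, h1, h4], by rw [add_mul, h2, h5]⟩, fun a => ⟨?_, ?_⟩⟩
        · rw [add_mul, add_mul, (h3 a).1, (h6 a).1, mul_add]
        · rw [conjTranspose_add, add_mul, add_mul, (h3 a).2, (h6 a).2, mul_add]
      smul_mem' := by
        rintro c x ⟨⟨h1, h2⟩, h3⟩
        refine ⟨⟨by rw [mul_smul_comm, h1], by rw [smul_mul_assoc, h2]⟩, fun a => ⟨?_, ?_⟩⟩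
        · rw [smul_mul_assoc, smul_mul_assoc, (h3 a).1, mul_smul_comm]
        · rw [conjTranspose_smul, smul_mul_assoc, smul_mul_assoc, (h3 a).2, mul_smul_comm] }
  have hmem : ∀ x, x ∈ 𝒜 ↔ (p * x = x ∧ x * p = x) ∧
      ∀ a, x * M a * p = M a * x ∧ xᴴ * M a * p = M a * xᴴ := fun x => Iff.rfl
  have hprod : ∀ x y : Op n, (∀ a, x * M a * p = M a * x) → (∀ a, y * M a * p = M a * y) →
      p * y = y → ∀ a, x * y * M a * p = M a * (x * y) := by
    intro x y hx hy hpy a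
    calc x * y * M a * p = x * (y * M a * p) := by simp only [Matrix.mul_assoc]
      _ = x * M a * y := by rw [hy, Matrix.mul_assoc]
      _ = x * M a * p * y := by rw [Matrix.mul_assoc _ p, hpy]
      _ = _ := by rw [hx, Matrix.mul_assoc]
  have hstarp : ∀ {x : Op n}, x * p = x → p * xᴴ = xᴴ := by
    intro x hx
    have := congrArg conjTranspose hx
    rwa [conjTranspose_mul, hp] at this
  have hpstar : ∀ {x : Op n}, p * x = x → xᴴ * p = xᴴ := by
    intro x hx
    have := congrArg conjTranspose hx
    rwa [conjTranspose_mul, hp] at this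
  refine ⟨p, z, 𝒜, hp, hpz, ?_, ?_, ?_, fun x hx => hx.1, ?_, ?_⟩
  · rintro x ⟨⟨h1, h2⟩, h3⟩ y ⟨⟨h4, h5⟩, h6⟩
    refine ⟨⟨by rw [← Matrix.mul_assoc, h1], by rw [Matrix.mul_assoc, h5]⟩, fun a => ⟨?_, ?_⟩⟩
    · exact hprod x y (fun a => (h3 a).1) (fun a => (h6 a).1) h4 a
    · rw [conjTranspose_mul]
      exact hprod _ _ (fun a => (h6 a).2) (fun a => (h3 a).2) (hstarp h2) a
  · rintro x ⟨⟨h1, h2⟩, h3⟩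
    refine ⟨⟨hstarp h2, hpstar h1⟩, fun a => ⟨(h3 a).2, ?_⟩⟩
    rw [conjTranspose_conjTranspose]
    exact (h3 a).1
  · refine ⟨⟨hpp, hpp⟩, fun a => ⟨by rw [hpM], by rw [hp, hpM]⟩⟩
  · rintro x ⟨⟨h1, h2⟩, h3⟩ _ ⟨ρ, rfl⟩
    constructor
    · refine ⟨x * P ρ, ?_⟩
      refine Eq.trans ?_ (congrArg (x * ·) (hfix ρ))
      rw [hM (x * P ρ), hM (P ρ), Finset.mul_sum]
      refine Finset.sum_congr rfl fun a _ => ?_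
      calc M a * (x * P ρ) * (M a)ᴴ = (M a * x) * P ρ * (M a)ᴴ := by simp only [Matrix.mul_assoc]
        _ = x * M a * (p * P ρ) * (M a)ᴴ := by rw [← (h3 a).1]; simp only [Matrix.mul_assoc]
        _ = _ := by rw [hpP]; simp only [Matrix.mul_assoc]
    · refine ⟨P ρ * x, ?_⟩
      refine Eq.trans ?_ (congrArg (· * x) (hfix ρ))
      rw [hM (P ρ * x), hM (P ρ), Finset.sum_mul]
      refine Finset.sum_congr rfl fun a _ => ?_
      have h4 : x * (M a)ᴴ = p * (M a)ᴴ * x := by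
        have := congrArg conjTranspose (h3 a).2
        simp only [conjTranspose_mul, conjTranspose_conjTranspose, hp] at this
        rw [← this, Matrix.mul_assoc]
      calc M a * (P ρ * x) * (M a)ᴴ = M a * P ρ * (x * (M a)ᴴ) := by simp only [Matrix.mul_assoc]
        _ = M a * (P ρ * p) * (M a)ᴴ * x := by rw [h4]; simp only [Matrix.mul_assoc]
        _ = _ := by rw [hPp]
  · rintro _ ⟨ρ, rfl⟩ hρ
    rw [ext_iff_trace_mul_left]
    intro B
    rw [Matrix.mul_zero, trace_zero, ← hfix ρ, ← hE]
    -- Corners of fixed points of the dual map lie in the commutant: `E A = E B` moves `P` off the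
    -- traces, and the support projections are absorbed by cyclicity. They separate the range since
    -- `tr (B ρ) = tr (E B ρ)` there.
    have hAB : ∀ B, (∀ a, (p * E B * p) * M a * p = M a * (p * E B * p)) := by
      intro B a
      set A := p * E B * p with hA
      have hpA : p * A = A := by rw [hA, ← Matrix.mul_assoc, ← Matrix.mul_assoc, hpp]
      have hAp : A * p = A := by rw [hA, Matrix.mul_assoc, hpp]
      have hEA : E A = E B := by rw [hA, hEp, hEE]
      have hstar : Aᴴ = p * E Bᴴ * p := by
        rw [hA, conjTranspose_mul, conjTranspose_mul, hp, hEstar, Matrix.mul_assoc]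
      have hEA' : E Aᴴ = E Bᴴ := by rw [hstar, hEp, hEE]
      have hσp : P 1 * p = P 1 := hPp 1
      have key := kraus_mul_fixed_eq hM htr hσ (hfix 1) (A := A) ?_ ?_ a
      · have h5 : (A * M a - M a * A) * p = 0 := by
          conv_lhs => rw [hpz]
          rw [← Matrix.mul_assoc, key, Matrix.zero_mul]
        rw [sub_mul, sub_eq_zero] at h5
        rw [h5, Matrix.mul_assoc, hAp]
      · rw [← hE, hEA]
        calc (E B * (P 1 * Aᴴ)).trace = (E B * (p * P 1 * (Aᴴ * p))).trace := by
              rw [hpP, hpstar hpA]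
          _ = (E B * p * P 1 * Aᴴ * p).trace := by simp only [Matrix.mul_assoc]
          _ = (A * P 1 * Aᴴ).trace := by
              rw [trace_mul_comm, hA]; simp only [Matrix.mul_assoc]
      · rw [trace_mul_comm, ← hE, hEA']
        calc (E Bᴴ * (A * P 1)).trace = (E Bᴴ * (p * A * (P 1 * p))).trace := by rw [hpA, hσp]
          _ = (E Bᴴ * p * A * P 1 * p).trace := by simp only [Matrix.mul_assoc]
          _ = (Aᴴ * (A * P 1)).trace := by
              rw [trace_mul_comm, hstar]; simp only [Matrix.mul_assoc]
          _ = _ := trace_mul_comm _ _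
    have hmemB : p * E B * p ∈ 𝒜 := by
      refine ⟨⟨by rw [← Matrix.mul_assoc, ← Matrix.mul_assoc, hpp], by rw [Matrix.mul_assoc, hpp]⟩,
        fun a => ⟨hAB B a, ?_⟩⟩
      have hstar : (p * E B * p)ᴴ = p * E Bᴴ * p := by
        rw [conjTranspose_mul, conjTranspose_mul, hp, hEstar, Matrix.mul_assoc]
      rw [hstar]
      exact hAB _ a
    have h7 := hρ _ hmemB
    rw [← h7]
    calc (E B * P ρ).trace = (E B * (p * (P ρ * p))).trace := by rw [hPp, hpP]
      _ = (E B * p * P ρ * p).trace := by simp only [Matrix.mul_assoc]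
      _ = _ := by rw [trace_mul_comm]; simp only [Matrix.mul_assoc]

end KrausProjection

/-! ### The range of a trace-preserving Kraus idempotent. -/

section RangeStructure

open Matrix

variable {n : ℕ}

/-- The partial trace over the first tensor factor. -/
def partialTraceLeft {f g : ℕ} (S : Matrix (Fin f × Fin g) (Fin f × Fin g) ℂ) :
    Matrix (Fin g) (Fin g) ℂ :=
  ∑ m : Fin f, S.submatrix (fun s => (m, s)) fun s => (m, s)

theorem posDef_partialTraceLeft {f g : ℕ} (hf : 0 < f)
    {S : Matrix (Fin f × Fin g) (Fin f × Fin g) ℂ} (hS : S.PosDef) :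
    (partialTraceLeft S).PosDef :=
  have : Nonempty (Fin f) := ⟨⟨0, hf⟩⟩
  posDef_sum Finset.univ_nonempty fun m _ => hS.submatrix (Prod.mk_right_injective m)

/-- Sandwiching by matrix units of the first factor turns any operator into a product; this is how
the bimodule property produces the fixed states `τ`. -/
theorem sum_single_kronecker_mul_mul {f g : ℕ} (S : Matrix (Fin f × Fin g) (Fin f × Fin g) ℂ)
    (i j : Fin f) :
    ∑ m, (single i m (1 : ℂ) ⊗ₖ (1 : Matrix (Fin g) (Fin g) ℂ)) * S *
      (single m j (1 : ℂ) ⊗ₖ (1 : Matrix (Fin g) (Fin g) ℂ)) =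
      single i j (1 : ℂ) ⊗ₖ partialTraceLeft S := by
  ext ⟨a, s⟩ ⟨b, t⟩
  simp only [partialTraceLeft, Matrix.sum_apply, kroneckerMap_apply, submatrix_apply,
    Finset.mul_sum]
  refine Finset.sum_congr rfl fun m _ => ?_
  simp only [Matrix.mul_apply, Fintype.sum_prod_type, kroneckerMap_apply, Matrix.one_apply,
    single_apply, mul_ite, mul_one, mul_zero, ite_mul, zero_mul, one_mul, Finset.sum_ite_eq,
    Finset.sum_ite_eq', Finset.mem_univ, if_true]
  by_cases ha : i = a <;> by_cases hb : j = b <;> simp [ha, hb]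

/-- Since `p = z† σ`, a vector killed by `σ` is killed by `p`, which fixes the block. -/
theorem posDef_block_compression {σ p z : Op n} (hσ : σ.PosSemidef) (hp : pᴴ = p) (hpz : p = σ * z)
    (b : Block n) (hb : p * b.proj = b.proj) : (b.W * σ * b.Wᴴ).PosDef := by
  have hS := hσ.mul_mul_conjTranspose_same b.W
  rw [posDef_iff_dotProduct_mulVec]
  refine ⟨hS.isHermitian, fun {x} hx => ?_⟩
  refine lt_of_le_of_ne (hS.dotProduct_mulVec_nonneg x) fun h0 => hx ?_
  have h1 : star (b.Wᴴ *ᵥ x) ⬝ᵥ (σ *ᵥ (b.Wᴴ *ᵥ x)) = 0 := by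
    rw [h0, star_mulVec, conjTranspose_conjTranspose, ← dotProduct_mulVec, mulVec_mulVec,
      mulVec_mulVec]
  rw [hσ.dotProduct_mulVec_zero_iff] at h1
  have hp' : p = zᴴ * σ := by
    rw [← hp, hpz, conjTranspose_mul, hσ.isHermitian.eq]
  have hbW : p * b.Wᴴ = b.Wᴴ := by
    have : b.Wᴴ = b.proj * b.Wᴴ := by
      rw [Block.proj, Matrix.mul_assoc, b.W_self, Matrix.mul_one]
    rw [this, ← Matrix.mul_assoc, hb]
  have h2 : b.Wᴴ *ᵥ x = 0 := by
    rw [← hbW, ← mulVec_mulVec, hp', ← mulVec_mulVec, h1, mulVec_zero]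
  rw [← one_mulVec x, ← b.W_self, ← mulVec_mulVec, h2, mulVec_zero]

/-- Sandwiching `P 1` inside each block shows that the range contains every `B(F) ⊗ τ`. Conversely,
an element of the range and the injection of its compression have the same trace pairings with the
algebra, so they agree. -/
theorem exists_blockData_range_eq {P : SuperOp n} (hK : IsKraus P)
    (htr : ∀ X, (P X).trace = X.trace) (hi : P * P = P) :
    ∃ D : BlockData n, LinearMap.range P = LinearMap.range D.injection := by
  obtain ⟨ι, _, M, hM⟩ := hK
  obtain ⟨p, z, 𝒜, hp, hpz, hmul, hstar, hp𝒜, hunit, hbim, hsep⟩ := exists_range_bimodule hM htr hi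
  obtain ⟨K, b, horth, hemb, hsum, hex⟩ := exists_blocks 𝒜 hmul hstar
  have hσ : (P 1).PosSemidef := kraus_posSemidef hM PosSemidef.one
  have hS : ∀ k, ((b k).W * P 1 * (b k).Wᴴ).PosDef := fun k =>
    posDef_block_compression hσ hp hpz (b k) ((b k).emb_one ▸ (hunit _ (hemb k 1)).1)
  let τ' : ∀ k, Matrix (Fin (b k).g) (Fin (b k).g) ℂ := fun k =>
    partialTraceLeft ((b k).W * P 1 * (b k).Wᴴ)
  have hτ' : ∀ k, (τ' k).PosDef := fun k => posDef_partialTraceLeft (b k).f_pos (hS k)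
  have htrpos : ∀ k, 0 < (τ' k).trace := fun k =>
    have : Nonempty (Fin (b k).g) := ⟨⟨0, (b k).g_pos⟩⟩
    (hτ' k).trace_pos
  let D : BlockData n :=
    { K := K
      f := fun k => (b k).f
      g := fun k => (b k).g
      f_pos := fun k => (b k).f_pos
      W := fun k => (b k).W
      W_self := fun k => (b k).W_self
      W_orth := horth
      τ := fun k => ((τ' k).trace)⁻¹ • τ' k
      τ_posDef := fun k => (hτ' k).smul (inv_pos.2 (htrpos k))
      τ_trace := fun k => by
        rw [trace_smul, smul_eq_mul, inv_mul_cancel₀ (htrpos k).ne'] }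
  have hσmem : P 1 ∈ LinearMap.range P := ⟨1, rfl⟩
  have hblock : ∀ k (Y : Matrix (Fin (b k).f) (Fin (b k).f) ℂ),
      (b k).Wᴴ * (Y ⊗ₖ τ' k) * (b k).W ∈ LinearMap.range P := by
    intro k Y
    induction Y using Matrix.induction_on' with
    | h_zero => simp
    | h_add Y Y' h h' =>
      rw [add_kronecker, Matrix.mul_add, Matrix.add_mul]
      exact Submodule.add_mem _ h h'
    | h_std_basis i j c =>
      have h1 : single i j c = c • single i j (1 : ℂ) := by simp [smul_single]
      rw [h1, smul_kronecker, Matrix.mul_smul, Matrix.smul_mul]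
      refine Submodule.smul_mem _ _ ?_
      rw [← sum_single_kronecker_mul_mul, Matrix.mul_sum, Matrix.sum_mul]
      refine Submodule.sum_mem _ fun m _ => ?_
      have h2 := (hbim _ (hemb k (single m j 1)) _ ((hbim _ (hemb k (single i m 1)) _ hσmem).1)).2
      simpa only [Block.emb, Matrix.mul_assoc] using h2
  have hle : LinearMap.range D.injection ≤ LinearMap.range P := by
    rintro _ ⟨X, rfl⟩
    change ∑ k, (D.W k)ᴴ * (X k ⊗ₖ D.τ k) * D.W k ∈ _
    refine Submodule.sum_mem _ fun k _ => ?_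
    have : X k ⊗ₖ D.τ k = ((τ' k).trace)⁻¹ • (X k ⊗ₖ τ' k) := kronecker_smul _ _ _
    rw [this, Matrix.mul_smul, Matrix.smul_mul]
    exact Submodule.smul_mem _ _ (hblock k (X k))
  refine ⟨D, le_antisymm (fun ρ hρ => ⟨D.compression ρ, ?_⟩) hle⟩
  rw [eq_comm, ← sub_eq_zero]
  refine hsep _ (Submodule.sub_mem _ hρ (hle ⟨_, rfl⟩)) fun x hx => ?_
  have hx' : ∃ X : D.Reduced, x = D.embed X := by
    choose X hX using hex x hx
    refine ⟨X, (hsum x hx).trans (Finset.sum_congr rfl fun k _ => hX k)⟩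
  obtain ⟨X, rfl⟩ := hx'
  rw [mul_sub, trace_sub, D.trace_embed_mul, D.trace_embed_mul, D.compression_injection, sub_self]

end RangeStructure

/-! ### Matrix units, and the action of a Kraus map on the support. -/

namespace BlockData

open Matrix

variable {n : ℕ} (D : BlockData n)

theorem compression_mul_embed (X : D.Reduced) (Z : Op n) :
    D.compression (Z * D.embed X) = D.compression Z * X := by
  funext k
  have h : D.embed X * (D.W k)ᴴ =
      (D.W k)ᴴ * (X k ⊗ₖ (1 : Matrix (Fin (D.g k)) (Fin (D.g k)) ℂ)) := by
    have := congrArg conjTranspose (D.W_mul_blockSum (fun k => (star X) k ⊗ₖ 1) k)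
    rw [conjTranspose_mul, ← embed, conjTranspose_embed, star_star, conjTranspose_mul,
      conjTranspose_kronecker, conjTranspose_one, Pi.star_apply, star_eq_conjTranspose,
      conjTranspose_conjTranspose] at this
    exact this
  rw [compression_apply, Matrix.mul_assoc, Matrix.mul_assoc, h, ← Matrix.mul_assoc,
    ← Matrix.mul_assoc, partialTrace_mul_kronecker_one, Pi.mul_apply, compression_apply]

/-- The standard basis of matrix units of the reduced algebra. -/
def unitBasis : Module.Basis (Σ k, Fin (D.f k) × Fin (D.f k)) ℂ D.Reduced :=
  Pi.basis fun k => Matrix.stdBasis ℂ (Fin (D.f k)) (Fin (D.f k))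

/-- The matrix units of the reduced algebra. -/
def matrixUnit (k : Fin D.K) (i j : Fin (D.f k)) : D.Reduced := Pi.single k (single i j 1)

theorem unitBasis_apply (p : Σ k, Fin (D.f k) × Fin (D.f k)) :
    D.unitBasis p = D.matrixUnit p.1 p.2.1 p.2.2 := by
  rw [unitBasis, Pi.basis_apply, matrixUnit, ← Matrix.stdBasis_eq_single]

theorem trace_eq_sum (K : D.Reduced →ₗ[ℂ] D.Reduced) :
    LinearMap.trace ℂ _ K = ∑ k, ∑ i, ∑ j, K (D.matrixUnit k i j) k i j := by
  rw [LinearMap.trace_eq_matrix_trace ℂ D.unitBasis, Matrix.trace, Fintype.sum_sigma]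
  refine Finset.sum_congr rfl fun k _ => ?_
  rw [Fintype.sum_prod_type]
  refine Finset.sum_congr rfl fun i _ => Finset.sum_congr rfl fun j _ => ?_
  rw [diag_apply, LinearMap.toMatrix_apply, unitBasis_apply, unitBasis, Pi.basis_repr]
  rfl

theorem star_matrixUnit (k : Fin D.K) (i j : Fin (D.f k)) :
    star (D.matrixUnit k i j) = D.matrixUnit k j i := by
  funext l
  by_cases h : l = k
  · subst h
    simp [matrixUnit, star_eq_conjTranspose, conjTranspose_single]
  · simp [matrixUnit, Pi.single_eq_of_ne h]

theorem reducedTrace_matrixUnit_mul (k : Fin D.K) (i j : Fin (D.f k)) (Y : D.Reduced) :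
    D.reducedTrace (D.matrixUnit k i j * Y) = Y k j i := by
  rw [reducedTrace, Finset.sum_eq_single k]
  · rw [Pi.mul_apply, matrixUnit, Pi.single_eq_same, trace_single_mul]
    simp
  · intro l _ hl
    rw [Pi.mul_apply, matrixUnit, Pi.single_eq_of_ne hl, Matrix.zero_mul, trace_zero]
  · simp

theorem matrixUnit_mul_matrixUnit (k : Fin D.K) (i j : Fin (D.f k)) :
    D.matrixUnit k j i * D.matrixUnit k i j = D.matrixUnit k j j := by
  rw [matrixUnit, matrixUnit, matrixUnit, ← Pi.single_mul, single_mul_single_same, mul_one]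

theorem scalars_mul_matrixUnit (s : Fin D.K → ℂ) (k : Fin D.K) (i j : Fin (D.f k)) :
    D.scalars s * D.matrixUnit k i j = s k • D.matrixUnit k i j := by
  rw [scalars_mul]
  funext l
  by_cases h : l = k
  · subst h; rfl
  · simp [matrixUnit, Pi.single_eq_of_ne h]

theorem matrixUnit_mul_scalars (s : Fin D.K → ℂ) (k : Fin D.K) (i j : Fin (D.f k)) :
    D.matrixUnit k i j * D.scalars s = s k • D.matrixUnit k i j := by
  rw [← scalars_mul_matrixUnit, mul_scalars, scalars_mul]

theorem reducedTrace_eq_zero_imp {Y : D.Reduced}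
    (h : ∀ X, D.reducedTrace (X * Y) = 0) : Y = 0 := by
  funext k
  ext i j
  exact (D.reducedTrace_matrixUnit_mul k j i Y).symm.trans (h _)

theorem reducedTrace_comm (X Y : D.Reduced) :
    D.reducedTrace (X * Y) = D.reducedTrace (Y * X) :=
  Finset.sum_congr rfl fun _ _ => trace_mul_comm _ _

theorem reducedTrace_add (X Y : D.Reduced) :
    D.reducedTrace (X + Y) = D.reducedTrace X + D.reducedTrace Y := by
  simp [reducedTrace, Finset.sum_add_distrib]

theorem reducedTrace_sub (X Y : D.Reduced) :
    D.reducedTrace (X - Y) = D.reducedTrace X - D.reducedTrace Y := by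
  simp [reducedTrace, Finset.sum_sub_distrib]

/-- A trace-preserving Kraus map fixing the range of the injection acts on the support like the
block compression. -/
theorem compression_eq_of_fixes_range {P : SuperOp n} (hK : IsKraus P)
    (htr : ∀ X, (P X).trace = X.trace) (hfix : ∀ X, P (D.injection X) = D.injection X)
    {X : Op n} (hX : D.supportProj * X * D.supportProj = X) :
    D.compression (P X) = D.compression X := by
  obtain ⟨ι, _, M, hM⟩ := hK
  rw [← sub_eq_zero]
  refine D.reducedTrace_eq_zero_imp fun Y => ?_
  rw [mul_sub, reducedTrace_sub, ← trace_embed_mul, ← trace_embed_mul, sub_eq_zero]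
  have hω : (D.injection (D.scalars 1)).PosSemidef :=
    D.posSemidef_injection_scalars fun _ => zero_le_one
  -- The trace hypotheses are immediate here: products of the faithful fixed operator with embedded
  -- elements are again injected, hence fixed.
  have hcomm : ∀ a, (D.embed Y * M a - M a * D.embed Y) * D.supportProj = 0 := by
    intro a
    refine D.mul_supportProj_eq_zero (s := 1) (fun _ => one_ne_zero) ?_
    refine kraus_mul_fixed_eq hM htr hω (hfix _) ?_ ?_ a
    · rw [conjTranspose_embed, injection_mul_embed, hfix, Matrix.mul_assoc, injection_mul_embed]
    · rw [conjTranspose_embed, embed_mul_injection, hfix]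
  have hYp : D.embed Y * D.supportProj = D.embed Y := by
    rw [supportProj_eq, embed_mul_embed, mul_one]
  have hpX : D.supportProj * X = X := by
    have hpp : D.supportProj * D.supportProj = D.supportProj := by
      rw [supportProj_eq, embed_mul_embed, mul_one]
    rw [← hX, ← Matrix.mul_assoc, ← Matrix.mul_assoc, hpp]
  have h1 : ∀ a, D.embed Y * M a * X = M a * (D.embed Y * X) := by
    intro a
    have := congrArg (· * X) (hcomm a)
    simp only [Matrix.mul_assoc, hpX, Matrix.zero_mul, sub_mul] at this
    rw [sub_eq_zero] at this
    rw [Matrix.mul_assoc]; exact this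
  rw [← htr (D.embed Y * X), hM, hM, Finset.mul_sum]
  congr 1
  refine Finset.sum_congr rfl fun a _ => ?_
  rw [← h1]
  simp only [Matrix.mul_assoc]

/-! ### The reduced generator is Hamiltonian. -/

section Generator

variable {D} {L : SuperOp n} {G : Op n} {m : ℕ} {V : Fin m → Op n}

/-- The terms with `G` cancel on the right, so only the jump part is left. -/
theorem dissipation_identity (h : ∀ X, L X = G * X + X * Gᴴ + ∑ k, V k * X * (V k)ᴴ)
    (x ρ : Op n) :
    ∑ a, (x * V a - V a * x) * ρ * (x * V a - V a * x)ᴴ =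
      x * L ρ * xᴴ - x * L (ρ * xᴴ) - L (x * ρ) * xᴴ + L (x * ρ * xᴴ) := by
  have h1 : ∑ a, (x * V a - V a * x) * ρ * (x * V a - V a * x)ᴴ =
      x * (∑ k, V k * ρ * (V k)ᴴ) * xᴴ - x * (∑ k, V k * (ρ * xᴴ) * (V k)ᴴ) -
        (∑ k, V k * (x * ρ) * (V k)ᴴ) * xᴴ + ∑ k, V k * (x * ρ * xᴴ) * (V k)ᴴ := by
    simp only [Finset.mul_sum, Finset.sum_mul, ← Finset.sum_sub_distrib, ← Finset.sum_add_distrib]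
    refine Finset.sum_congr rfl fun a _ => ?_
    simp only [conjTranspose_sub, conjTranspose_mul]
    noncomm_ring
  rw [h1, h, h, h, h]
  noncomm_ring

variable {K : D.Reduced →ₗ[ℂ] D.Reduced}

theorem trace_dissipation_matrixUnit (h : ∀ X, L X = G * X + X * Gᴴ + ∑ k, V k * X * (V k)ᴴ)
    (htr : ∀ X, (L X).trace = 0) (hK : ∀ X, L (D.injection X) = D.injection (K X))
    (s : Fin D.K → ℂ) (k : Fin D.K) (i j : Fin (D.f k)) :
    ∑ a, ((D.embed (D.matrixUnit k i j) * V a - V a * D.embed (D.matrixUnit k i j)) *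
      D.injection (D.scalars s) *
      (D.embed (D.matrixUnit k i j) * V a - V a * D.embed (D.matrixUnit k i j))ᴴ).trace =
      K (D.scalars s) k j j - s k * K (D.matrixUnit k j i) k j i -
        s k * K (D.matrixUnit k i j) k i j := by
  rw [← trace_sum, dissipation_identity h, trace_add, htr, add_zero, trace_sub, trace_sub,
    trace_mul_comm, ← Matrix.mul_assoc, trace_mul_comm (L _), conjTranspose_embed,
    embed_mul_embed, injection_mul_embed, embed_mul_injection, hK, hK, hK, trace_embed_mul,
    trace_embed_mul, trace_embed_mul, compression_injection, compression_injection,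
    compression_injection, star_matrixUnit, matrixUnit_mul_matrixUnit, scalars_mul_matrixUnit,
    matrixUnit_mul_scalars, map_smul, map_smul, mul_smul_comm, mul_smul_comm,
    reducedTrace_matrixUnit_mul]
  have : ∀ (c : ℂ) (Y : D.Reduced), D.reducedTrace (c • Y) = c * D.reducedTrace Y := by
    intro c Y; simp [reducedTrace, Finset.mul_sum]
  rw [this, this, reducedTrace_matrixUnit_mul, reducedTrace_matrixUnit_mul]

/-- Summed over the matrix units with weights, the dissipation terms give `-2 tr K`, whose real part
is zero. They are nonnegative, so each vanishes, and with it each commutator on the support. -/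
theorem jump_commutes_embed (h : ∀ X, L X = G * X + X * Gᴴ + ∑ k, V k * X * (V k)ᴴ)
    (htr : ∀ X, (L X).trace = 0) (hK : ∀ X, L (D.injection X) = D.injection (K X))
    (hre : (LinearMap.trace ℂ _ K).re = 0) (a : Fin m) (X : D.Reduced) :
    (D.embed X * V a - V a * D.embed X) * D.supportProj = 0 := by
  -- Blocks differ in size. Taking `s k = f k` with weight `1 / f k` gives both traces of `K`
  -- coefficient one and leaves, from the first term, the total trace of `K (D.scalars s)`, which is
  -- zero.
  let s : Fin D.K → ℂ := fun k => (D.f k : ℂ)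
  have hf : ∀ k, (D.f k : ℂ) ≠ 0 := fun k => Nat.cast_ne_zero.2 (D.f_pos k).ne'
  have hω : (D.injection (D.scalars s)).PosSemidef :=
    D.posSemidef_injection_scalars fun k => Nat.cast_nonneg _
  let q : (Σ k, Fin (D.f k) × Fin (D.f k)) → ℂ := fun p =>
    ∑ a, ((D.embed (D.unitBasis p) * V a - V a * D.embed (D.unitBasis p)) *
      D.injection (D.scalars s) *
      (D.embed (D.unitBasis p) * V a - V a * D.embed (D.unitBasis p))ᴴ).trace
  have hq0 : ∀ p, 0 ≤ q p := fun p =>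
    Finset.sum_nonneg fun a _ => (hω.mul_mul_conjTranspose_same _).trace_nonneg
  have hqsum : ∑ p, (D.f p.1 : ℂ)⁻¹ * q p = -2 * LinearMap.trace ℂ _ K := by
    have h1 : ∀ (k : Fin D.K) (i j : Fin (D.f k)), (D.f k : ℂ)⁻¹ * q ⟨k, i, j⟩ =
        (D.f k : ℂ)⁻¹ * K (D.scalars s) k j j - K (D.matrixUnit k j i) k j i -
          K (D.matrixUnit k i j) k i j := by
      intro k i j
      simp only [q, unitBasis_apply, trace_dissipation_matrixUnit h htr hK, s]
      have := hf k
      field_simp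
    have h2 : ∑ k, ∑ j, K (D.scalars s) k j j = 0 := by
      have := htr (D.injection (D.scalars s))
      rw [hK, trace_injection] at this
      exact this
    rw [Fintype.sum_sigma]
    simp only [Fintype.sum_prod_type, h1, Finset.sum_sub_distrib]
    rw [← trace_eq_sum]
    have h3 : ∀ k, ∑ i : Fin (D.f k), ∑ j, (D.f k : ℂ)⁻¹ * K (D.scalars s) k j j =
        ∑ j, K (D.scalars s) k j j := by
      intro k
      rw [Finset.sum_const, ← Finset.mul_sum, nsmul_eq_mul, Finset.card_univ, Fintype.card_fin,
        ← mul_assoc, mul_inv_cancel₀ (hf k), one_mul]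
    have h4 : ∑ k, ∑ i, ∑ j, K (D.matrixUnit k j i) k j i = LinearMap.trace ℂ _ K := by
      rw [trace_eq_sum]
      exact Finset.sum_congr rfl fun k _ => Finset.sum_comm
    rw [h4]
    simp only [h3, h2]
    ring
  have hq : ∀ p, q p = 0 := by
    have hre' : ∑ p, ((D.f p.1 : ℂ)⁻¹ * q p).re = 0 := by
      rw [← Complex.re_sum, hqsum]
      simp [hre]
    have hnn : ∀ p, 0 ≤ (D.f p.1 : ℂ)⁻¹ * q p := fun p =>
      mul_nonneg (inv_nonneg.2 (Nat.cast_nonneg _)) (hq0 p)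
    intro p
    have h1 := (Finset.sum_eq_zero_iff_of_nonneg fun p _ => (Complex.le_def.1 (hnn p)).1).1 hre' p
      (Finset.mem_univ p)
    have h2 : (D.f p.1 : ℂ)⁻¹ * q p = 0 :=
      Complex.ext h1 (Complex.le_def.1 (hnn p)).2.symm
    exact (mul_eq_zero.1 h2).resolve_left (inv_ne_zero (hf _))
  let F : D.Reduced →ₗ[ℂ] Op n :=
    { toFun := fun X => (D.embed X * V a - V a * D.embed X) * D.supportProj
      map_add' := fun X Y => by rw [embed_add]; noncomm_ring
      map_smul' := fun c X => by
        rw [embed_smul, smul_mul_assoc, mul_smul_comm, ← smul_sub, smul_mul_assoc]; rfl }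
  have hF : F = 0 := by
    refine D.unitBasis.ext fun p => ?_
    have h1 := mul_eq_zero_of_sum_trace_eq_zero hω (hq p) a
    exact D.mul_supportProj_eq_zero hf h1
  exact LinearMap.congr_fun hF X

/-- Once the jumps commute with the reduced algebra on `ω = D.injection 1`, compressing `L` gives `K
X = X K(1) + [g, X]`. Trace preservation forces `K 1 = 0`, and preservation of adjoints gives `[g†,
X] = -[g, X]`, so only the anti-Hermitian part of `g` matters. -/
theorem exists_hamiltonian (h : ∀ X, L X = G * X + X * Gᴴ + ∑ k, V k * X * (V k)ᴴ)
    (htr : ∀ X, (L X).trace = 0) (hK : ∀ X, L (D.injection X) = D.injection (K X))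
    (hre : (LinearMap.trace ℂ _ K).re = 0) :
    ∃ H : D.Reduced, (∀ k, (H k).IsHermitian) ∧
      ∀ X : D.Reduced, K X = -(Complex.I • (H * X - X * H)) := by
  let ω := D.injection 1
  have hpω : D.supportProj * ω = ω := by rw [supportProj_eq, embed_mul_injection, one_mul]
  have hV : ∀ a X, V a * D.embed X * ω = D.embed X * V a * ω := by
    intro a X
    have := congrArg (· * ω) (jump_commutes_embed h htr hK hre a X)
    simp only [Matrix.mul_assoc, hpω, Matrix.zero_mul, sub_mul] at this
    rw [sub_eq_zero] at this
    rw [Matrix.mul_assoc, Matrix.mul_assoc]; exact this.symm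
  have hωX : ∀ X, D.injection X = D.embed X * ω := fun X => by
    rw [embed_mul_injection, mul_one]
  have hXω : ∀ X, ω * D.embed X = D.embed X * ω := fun X => by
    rw [embed_mul_injection, injection_mul_embed, mul_one, one_mul]
  let g := D.compression (G * ω)
  have hKX : ∀ X, K X = X * K 1 + (g * X - X * g) := by
    intro X
    have h1 : L (D.embed X * ω) = D.embed X * L ω + (G * ω * D.embed X - D.embed X * (G * ω)) := by
      rw [h, h ω, mul_add, mul_add, Finset.mul_sum]
      have h2 : ∀ a, V a * (D.embed X * ω) * (V a)ᴴ = D.embed X * (V a * ω * (V a)ᴴ) := by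
        intro a
        rw [← Matrix.mul_assoc (V a), hV]; simp only [Matrix.mul_assoc]
      simp only [h2]
      rw [Matrix.mul_assoc G ω, hXω]
      noncomm_ring
    have h3 := congrArg D.compression h1
    rw [← hωX, hK, compression_injection, map_add, map_sub, compression_embed_mul,
      compression_mul_embed, compression_embed_mul, hK, compression_injection] at h3
    exact h3
  have hK1 : K 1 = 0 := by
    refine D.reducedTrace_eq_zero_imp fun X => ?_
    have h1 : D.reducedTrace (K X) = 0 := by rw [← trace_injection, ← hK, htr]
    rw [hKX, reducedTrace_add, reducedTrace_sub, D.reducedTrace_comm g X, sub_self, add_zero] at h1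
    exact h1
  have hKX' : ∀ X, K X = g * X - X * g := fun X => by rw [hKX, hK1, mul_zero, zero_add]
  have hstar : ∀ X, K (star X) = star (K X) := by
    intro X
    apply D.injection_injective
    rw [← hK, ← conjTranspose_injection, ← conjTranspose_injection, ← hK, h, h]
    simp only [conjTranspose_add, conjTranspose_mul, conjTranspose_conjTranspose,
      conjTranspose_sum, Matrix.mul_assoc]
    rw [add_comm (G * _)]
  have hanti : ∀ X, star g * X - X * star g = -(g * X - X * g) := by
    intro X
    have h1 := hstar (star X)
    rw [star_star, hKX', hKX', star_sub, star_mul, star_mul, star_star] at h1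
    rw [h1]; abel
  -- Then `-i [H, X] = ½ [g - g†, X] = [g, X]`.
  refine ⟨(Complex.I / 2) • (g - star g), fun k => ?_, fun X => ?_⟩
  · have h1 : star ((Complex.I / 2) • (g - star g)) = (Complex.I / 2) • (g - star g) := by
      rw [star_smul, star_sub, star_star, ← neg_sub g, smul_neg, ← neg_smul]
      congr 1
      rw [Complex.star_def, map_div₀, Complex.conj_I, map_ofNat]
      ring
    exact congrFun h1 k
  · have h2 : (g - star g) * X - X * (g - star g) = (2 : ℂ) • (g * X - X * g) := by
      have : (g - star g) * X - X * (g - star g) =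
          (g * X - X * g) - (star g * X - X * star g) := by noncomm_ring
      rw [this, hanti, sub_neg_eq_add, two_smul]
    rw [smul_mul_assoc, mul_smul_comm, ← smul_sub, h2, smul_smul, smul_smul, ← neg_smul, hKX']
    have : -(Complex.I * (Complex.I / 2) * 2) = 1 := by
      rw [mul_assoc, div_mul_cancel₀ _ (two_ne_zero), Complex.I_mul_I, neg_neg]
    rw [this, one_smul]

end Generator

end BlockData

/-! ### Complete positivity in terms of `star Y * Y`. -/

section CompletePositivity

open Matrix

variable {n : ℕ}

/-- The flattened sum is positive semidefinite, hence `B† B` with `B` square; reshaping `B` replaces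
a sum over rectangular factors by the single square one that `IsCompletelyPositive` asks for. -/
theorem exists_eq_star_mul_self {m p : ℕ} {ι : Type*} [Fintype ι] {κ : ι → Type*}
    [∀ r, Fintype (κ r)] (Z : ∀ r, Fin m → Matrix (κ r) (Fin p) ℂ) :
    ∃ Y : Matrix (Fin m) (Fin m) (Matrix (Fin p) (Fin p) ℂ),
      ∀ i j, (star Y * Y) i j = ∑ r, (Z r i)ᴴ * Z r j := by
  let F : ∀ r, Matrix (κ r) (Fin m × Fin p) ℂ := fun r => Matrix.of fun c x => Z r x.1 c x.2
  obtain ⟨B, hB⟩ := (posSemidef_sum Finset.univ fun r _ =>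
    posSemidef_conjTranspose_mul_self (F r)).exists_conjTranspose_mul_self
  refine ⟨Matrix.of fun l j => Matrix.of fun a b => B (l, a) (j, b), fun i j => ?_⟩
  ext a b
  have h := congrFun (congrFun hB (i, a)) (j, b)
  simp only [Matrix.sum_apply, Matrix.mul_apply, conjTranspose_apply, F, of_apply,
    Fintype.sum_prod_type] at h
  simp only [star_eq_conjTranspose, Matrix.mul_apply, Matrix.sum_apply, conjTranspose_apply,
    of_apply, h]

theorem IsCompletelyPositive.comp {A B C : Type} [Ring A] [StarRing A] [Algebra ℂ A]
    [Ring B] [StarRing B] [Algebra ℂ B] [Ring C] [StarRing C] [Algebra ℂ C]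
    {Ψ : B →ₗ[ℂ] C} {Φ : A →ₗ[ℂ] B} (hΨ : IsCompletelyPositive Ψ) (hΦ : IsCompletelyPositive Φ) :
    IsCompletelyPositive (Ψ ∘ₗ Φ) := by
  intro m X
  obtain ⟨Y, hY⟩ := hΦ m X
  obtain ⟨Z, hZ⟩ := hΨ m Y
  refine ⟨Z, ?_⟩
  rw [← hZ, ← hY]
  rfl

theorem IsKraus.isCompletelyPositive {Φ : SuperOp n} (h : IsKraus Φ) : IsCompletelyPositive Φ := by
  obtain ⟨ι, _, M, hM⟩ := h
  intro m X
  obtain ⟨Y, hY⟩ := exists_eq_star_mul_self (ι := Fin m × ι) (κ := fun _ => Fin n)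
    fun r j => X r.1 j * (M r.2)ᴴ
  refine ⟨Y, ?_⟩
  ext1 i j
  rw [hY, Fintype.sum_prod_type, map_apply, Matrix.mul_apply, map_sum]
  refine Finset.sum_congr rfl fun l _ => ?_
  rw [hM]
  refine Finset.sum_congr rfl fun a _ => ?_
  rw [star_apply, conjTranspose_mul, conjTranspose_conjTranspose, star_eq_conjTranspose]
  simp only [Matrix.mul_assoc]

namespace BlockData

variable (D : BlockData n)

theorem isCompletelyPositive_compression : IsCompletelyPositive D.compression := by
  intro m X
  have h : ∀ k, ∃ Y : Matrix (Fin m) (Fin m) (Matrix (Fin (D.f k)) (Fin (D.f k)) ℂ),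
      ∀ i j, (star Y * Y) i j = D.compression ((star X * X) i j) k := by
    intro k
    -- The partial trace is a sum over `s`; its `s`-th term uses the columns of `(D.W k)ᴴ` with
    -- second index `s`.
    obtain ⟨Y, hY⟩ := exists_eq_star_mul_self (ι := Fin m × Fin (D.g k)) (κ := fun _ => Fin n)
      fun r j => X r.1 j * (D.W k)ᴴ.submatrix id fun a => (a, r.2)
    refine ⟨Y, fun i j => ?_⟩
    rw [hY, Fintype.sum_prod_type, Matrix.mul_apply, map_sum, Finset.sum_apply]
    refine Finset.sum_congr rfl fun l _ => ?_
    rw [compression_apply, star_apply, star_eq_conjTranspose]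
    have h1 : D.W k * ((X l i)ᴴ * X l j) * (D.W k)ᴴ =
        (X l i * (D.W k)ᴴ)ᴴ * (X l j * (D.W k)ᴴ) := by
      rw [conjTranspose_mul, conjTranspose_conjTranspose]
      simp only [Matrix.mul_assoc]
    rw [h1]
    ext a b
    simp only [partialTrace, LinearMap.coe_mk, AddHom.coe_mk, of_apply, Matrix.sum_apply]
    refine Finset.sum_congr rfl fun s _ => ?_
    simp only [Matrix.mul_apply, conjTranspose_apply, submatrix_apply, id_eq]
  choose Y hY using h
  refine ⟨Matrix.of fun i j k => Y k i j, ?_⟩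
  ext1 i j
  funext k
  rw [map_apply, ← hY]
  simp only [Matrix.mul_apply, star_apply, of_apply, Finset.sum_apply, Pi.mul_apply, Pi.star_apply]

theorem isCompletelyPositive_injection : IsCompletelyPositive D.injection := by
  intro m X
  choose S hS using fun k => (D.τ_posDef k).posSemidef.exists_conjTranspose_mul_self
  obtain ⟨Y, hY⟩ := exists_eq_star_mul_self (ι := Fin m × Fin D.K)
    (κ := fun r => Fin (D.f r.2) × Fin (D.g r.2)) fun r j => (X r.1 j r.2 ⊗ₖ S r.2) * D.W r.2
  refine ⟨Y, ?_⟩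
  ext1 i j
  rw [hY, Fintype.sum_prod_type, map_apply, Matrix.mul_apply, map_sum]
  refine Finset.sum_congr rfl fun l _ => ?_
  rw [injection_eq, blockSum]
  refine Finset.sum_congr rfl fun k _ => ?_
  rw [Pi.mul_apply, star_apply, Pi.star_apply, star_eq_conjTranspose, hS, mul_kronecker_mul,
    conjTranspose_mul, conjTranspose_kronecker]
  simp only [Matrix.mul_assoc]

end BlockData

end CompletePositivity

/-! ### The center projection and the reduced dynamics. -/

section Reduction

open Matrix Filter Topology

attribute [local instance] Matrix.normedAddCommGroup Matrix.normedSpace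

variable {n : ℕ} {L P : SuperOp n} {D : BlockData n}

theorem IsCenterProjection.unique (hL : IsLindbladGenerator L) {Q : SuperOp n}
    (hP : IsCenterProjection L P) (hQc : Q * L = L * Q)
    (hQr : LinearMap.range Q = centerManifold L) (hQi : Q * Q = Q) : P = Q :=
  (lindblad_boundedFlow hL).projection_unique (V := Op n) hP.commute hP.range_eq hP.idempotent
    hQc hQr hQi

/-- Uniqueness identifies `P` with the limit of flow maps, so no Kraus form has to be extracted from
abstract complete positivity. -/
theorem IsCenterProjection.isKraus (hL : IsLindbladGenerator L) (hP : IsCenterProjection L P) :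
    IsKraus P := by
  obtain ⟨Q, hK, -, hi, hr, hc⟩ := lindblad_exists_projection hL
  rw [hP.unique hL hc hr hi]
  exact hK

theorem lindblad_existsUnique_isCenterProjection (hL : IsLindbladGenerator L) :
    ∃! P : SuperOp n, IsCenterProjection L P := by
  obtain ⟨Q, hK, ht, hi, hr, hc⟩ := lindblad_exists_projection hL
  exact ⟨Q, ⟨hK.isCompletelyPositive, ht, hi, hr, hc⟩, fun P hP => hP.unique hL hc hr hi⟩

theorem IsCenterProjection.apply_injection (hP : IsCenterProjection L P)
    (hD : D.IsWedderburn (centerManifold L)) (X : D.Reduced) :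
    P (D.injection X) = D.injection X := by
  have h : D.injection X ∈ LinearMap.range P := by
    rw [hP.range_eq, hD]; exact ⟨X, rfl⟩
  exact apply_eq_self_of_mem_range (V := Op n) hP.idempotent h

theorem IsCenterProjection.injection_compression (hP : IsCenterProjection L P)
    (hD : D.IsWedderburn (centerManifold L)) (X : Op n) :
    D.injection (D.compression (P X)) = P X := by
  have h : P X ∈ LinearMap.range D.injection := by
    rw [← hD, ← hP.range_eq]; exact ⟨X, rfl⟩
  obtain ⟨Y, hY⟩ := h
  rw [← hY, D.compression_injection]

theorem IsCenterProjection.generator_injection (hP : IsCenterProjection L P)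
    (hD : D.IsWedderburn (centerManifold L)) (X : D.Reduced) :
    L (D.injection X) = D.injection (D.reducedGenerator L P X) := by
  have h1 : P (L (D.injection X)) = L (D.injection X) := by
    rw [← Module.End.mul_apply, hP.commute, Module.End.mul_apply, hP.apply_injection hD]
  change _ = D.injection (D.compression (P (L (D.injection X))))
  rw [hP.injection_compression hD, h1]

/-- The injection intertwines the two flows, so the reduced evolution is the flow of `P ρ`.
Exactness and decay are then statements about `ρ - P ρ`. -/
theorem IsCenterProjection.error_eq (hP : IsCenterProjection L P)
    (hD : D.IsWedderburn (centerManifold L)) (t : ℝ) (ρ : Op n) :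
    expMap L t ρ - D.injection (expMap (D.reducedGenerator L P) t (D.reduction P ρ)) =
      expMap L t (ρ - P ρ) := by
  have h1 : D.injection (expMap (D.reducedGenerator L P) t (D.reduction P ρ)) =
      expMap L t (D.injection (D.reduction P ρ)) :=
    (expMap_intertwine (V := Op n) (V' := D.Reduced) L (D.reducedGenerator L P) D.injection
      (hP.generator_injection hD) t (D.reduction P ρ)).symm
  have h2 : D.injection (D.reduction P ρ) = P ρ := hP.injection_compression hD ρ
  rw [h1, h2]
  exact (expMap_sub (V := Op n) L t ρ (P ρ)).symm

/-- The injection carries eigenvectors of the reduced generator to eigenvectors of `L` in the center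
manifold, so all eigenvalues are imaginary; the trace is their sum. -/
theorem IsCenterProjection.trace_reducedGenerator_re (hP : IsCenterProjection L P)
    (hD : D.IsWedderburn (centerManifold L)) :
    (LinearMap.trace ℂ _ (D.reducedGenerator L P)).re = 0 := by
  have hev : ∀ z, Module.End.HasEigenvalue (D.reducedGenerator L P) z → z.re = 0 := by
    intro z hz
    obtain ⟨Y, hY⟩ := hz.exists_hasEigenvector
    by_contra hre
    have h1 : L (D.injection Y) = z • D.injection Y := by
      rw [hP.generator_injection hD, hY.apply_eq_smul, map_smul]
    have h2 : D.injection Y ∈ imaginarySpan (V := Op n) L := by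
      change _ ∈ centerManifold L
      rw [hD]; exact ⟨Y, rfl⟩
    have h3 : D.injection Y ∈ Module.End.maxGenEigenspace L z := by
      rw [Module.End.mem_maxGenEigenspace]
      exact ⟨1, by simp [h1]⟩
    have h4 := eq_zero_of_mem_imaginarySpan_of_mem_maxGenEigenspace (V := Op n) hre h2 h3
    exact hY.2 (D.injection_injective (h4.trans (map_zero _).symm))
  rw [Module.End.trace_eq_sum_roots_charpoly_of_splits (IsAlgClosed.splits _)]
  have h5 : ∀ s : Multiset ℂ, (∀ z ∈ s, z.re = 0) → s.sum.re = 0 := by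
    intro s
    induction s using Multiset.induction_on with
    | empty => simp
    | cons a s ih =>
      intro h
      rw [Multiset.sum_cons, Complex.add_re, h a (Multiset.mem_cons_self _ _),
        ih fun z hz => h z (Multiset.mem_cons_of_mem hz), add_zero]
  refine h5 _ fun z hz => hev z ?_
  rw [Module.End.hasEigenvalue_iff_isRoot_charpoly]
  exact Polynomial.isRoot_of_mem_roots hz

theorem spectralGap_le {z : ℂ} (hz : Module.End.HasEigenvalue L z) (hre : z.re ≠ 0) :
    spectralGap L ≤ |z.re| :=
  csInf_le ⟨0, by rintro _ ⟨w, -, -, rfl⟩; exact abs_nonneg _⟩ ⟨z, hz, hre, rfl⟩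

end Reduction

end

theorem theorem3p2 (n : ℕ) (L : SuperOp n) (hL : IsLindbladGenerator L) :
    -- the objects exist
    (∃! P : SuperOp n, IsCenterProjection L P) ∧
    (∃ D : BlockData n, D.IsWedderburn (centerManifold L)) ∧
    ∀ (P : SuperOp n) (D : BlockData n), IsCenterProjection L P →
      D.IsWedderburn (centerManifold L) →
      -- the reduction and the injection are a CPTP factorization of the projection
      (IsCompletelyPositive (D.reduction P) ∧
        (∀ X : Op n, D.reducedTrace (D.reduction P X) = X.trace)) ∧
      (IsCompletelyPositive D.injection ∧
        (∀ X : D.Reduced, (D.injection X).trace = D.reducedTrace X)) ∧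
      D.injection ∘ₗ D.reduction P = P ∧
      D.reduction P ∘ₗ D.injection = LinearMap.id ∧
      (∀ X : Op n, D.supportProj * X * D.supportProj = X →
        D.reduction P X = D.compression X) ∧
      -- exactness on the center manifold
      (∀ ρ ∈ centerManifold L, ∀ t : ℝ, 0 ≤ t →
        expMap L t ρ =
          D.injection (expMap (D.reducedGenerator L P) t (D.reduction P ρ))) ∧
      -- asymptotic exactness
      (∀ ρ : Op n, IsDensity ρ →
        Filter.Tendsto
          (fun t : ℝ => expMap L t ρ -
            D.injection (expMap (D.reducedGenerator L P) t (D.reduction P ρ)))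
          Filter.atTop (nhds 0)) ∧
      -- exponential decay of the error, in every norm
      (∀ (N : Seminorm ℂ (Op n)) (ρ : Op n), IsDensity ρ → ∀ δ : ℝ, 0 < δ →
        ∃ Γ : ℝ, 0 < Γ ∧ ∀ t : ℝ, 0 ≤ t →
          N (expMap L t ρ -
              D.injection (expMap (D.reducedGenerator L P) t (D.reduction P ρ))) ≤
            Γ * Real.exp (-(spectralGap L - δ) * t)) ∧
      -- if all eigenvalues are purely imaginary, there is no error at all
      (decayRates L = ∅ → ∀ (ρ : Op n) (t : ℝ), 0 ≤ t →
        expMap L t ρ =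
          D.injection (expMap (D.reducedGenerator L P) t (D.reduction P ρ))) ∧
      -- the reduced generator is Hamiltonian and block diagonal
      (∃ H : D.Reduced, (∀ k, (H k).IsHermitian) ∧
        ∀ X : D.Reduced,
          D.reducedGenerator L P X = -(Complex.I • (H * X - X * H))) := by
  -- The norm is auxiliary: it induces the entrywise topology in which the statement is read.
  let _ := Matrix.normedAddCommGroup (m := Fin n) (n := Fin n) (α := ℂ)
  let _ := Matrix.normedSpace (m := Fin n) (n := Fin n) (α := ℂ) (R := ℂ)
  have hB : BoundedFlow (V := Op n) L := lindblad_boundedFlow hL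
  refine ⟨lindblad_existsUnique_isCenterProjection hL, ?_, fun P D hP hD => ?_⟩
  · obtain ⟨Q, hK, ht, hi, hr, -⟩ := lindblad_exists_projection hL
    obtain ⟨D, hD⟩ := exists_blockData_range_eq hK ht hi
    exact ⟨D, hr.symm.trans hD⟩
  have hJR : ∀ X, D.injection (D.reduction P X) = P X := hP.injection_compression hD
  have hzero : ∀ t ρ, ρ - P ρ = 0 → expMap L t ρ =
      D.injection (expMap (D.reducedGenerator L P) t (D.reduction P ρ)) := by
    intro t ρ hρ
    rw [← sub_eq_zero, hP.error_eq hD, hρ]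
    exact (expMap_eq_exp (V := Op n) L t 0).trans (map_zero _)
  have hdec : ∀ ρ, ρ - P ρ ∈ decaySpace (V := Op n) L :=
    hB.sub_mem_decaySpace hP.commute hP.range_eq hP.idempotent
  refine ⟨⟨D.isCompletelyPositive_compression.comp hP.completelyPositive, fun X => ?_⟩,
    ⟨D.isCompletelyPositive_injection, D.trace_injection⟩, LinearMap.ext hJR,
    LinearMap.ext fun X => ?_, fun X hX => ?_, fun ρ hρ t _ => ?_, fun ρ _ => ?_,
    fun N ρ _ δ hδ => ?_, fun hempty ρ t _ => ?_, ?_⟩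
  · rw [← D.trace_injection, hJR, hP.trace_preserving]
  · change D.compression (P (D.injection X)) = X
    rw [hP.apply_injection hD, D.compression_injection]
  · exact D.compression_eq_of_fixes_range (hP.isKraus hL) hP.trace_preserving
      (hP.apply_injection hD) hX
  · refine hzero t ρ ?_
    rw [sub_eq_zero]
    exact (apply_eq_self_of_mem_range (V := Op n) hP.idempotent (hP.range_eq ▸ hρ)).symm
  · simp only [hP.error_eq hD]
    exact hB.tendsto_zero (hdec ρ)
  · simp only [hP.error_eq hD]
    exact hB.seminorm_expMap_le N (fun z hz hre => spectralGap_le hz hre) hδ (hdec ρ)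
  · refine hzero t ρ ?_
    have hbot : decaySpace (V := Op n) L = ⊥ := by
      refine decaySpace_eq_bot fun z hz => ?_
      by_contra hre
      have : |z.re| ∈ decayRates L := ⟨z, hz, hre, rfl⟩
      rw [hempty] at this
      exact this
    have := hdec ρ
    rwa [hbot, Submodule.mem_bot] at this
  · obtain ⟨G, m, V, h⟩ := lindblad_effective hL
    exact BlockData.exists_hamiltonian h (lindblad_trace hL) (hP.generator_injection hD)
      (hP.trace_reducedGenerator_re hD)
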